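/- Let $c\ge 0$ be an integer. A sparse 3-SAT formula here is a CNF formula on $n$ variables with at most $cn$ clauses, each of at most three literals. A set packing instance consists of a finite universe $U$, a family $\mathcal S$ of (distinct) subsets of $U$, and a parameter $r$; an $r$-packing is a choice of $r$ pairwise disjoint sets of $\mathcal S$. There are constants $0<a\le b$ and $e\in\mathbb N$, depending only on $c$, such that the following holds for every computable function $r:\mathbb N\to\mathbb N$ and every algorithm that computes $r(n)$ in time $t(n)$. There is an algorithm (a reduction) which, for all $n\ge 1$ with $r=r(n)\ge 2$, maps every 3-CNF formula $\varphi$ on $n$ variables with at most $cn$ clauses to a set packing instance $I=(U,\mathcal S,r)$ such that 1. $\varphi$ is satisfiable if and only if $I$ has an $r$-packing; 2. the running time is at most $t(n)+2^{e n/r}(nr)^{e}$, i.e. $2^{O(n/r)}\,\mathrm{poly}(n,r)$ besides the time spent on computing $r(n)$; 3. $a\,nr^2\le |U|\le b\,nr^2$, i.e. $|U|=\Theta(nr^2)$; 4. $a\,r\,2^{a n/r}\le|\mathcal S|\le b\,r\,2^{b n/r}$, i.e. $|\mathcal S|=\Theta\bigl(r\,2^{\Theta(n/r)}\bigr)$;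 5. (compactness) $|U|\le b\,r^3\log|\mathcal S|$, and for every real $K\ge1$ with $r\log r\le Kn$ also $a\,r^3\log|\mathcal S|\le K|U|$; that is, $|U|=r^3\,\Theta(\log|\mathcal S|)$ as long as $r\log r=O(n)$. Running time is the number of elementary steps of a program on binary trees (take a subtree, join two trees, test for the empty tree, conditional, while loop), plus the size of the output; numbers are written in unary. -/

import Mathlib

/-! ### Model of computation: first-order programs on binary trees, with a step count -/

/-- Binary trees (S-expressions), the data on which programs operate. -/
inductive Data : Type
  | nil : Data
  | cons : Data → Data → Data

namespace Data

/-- Number of nodes of a tree. -/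
def size : Data → ℕ
  | nil => 1
  | cons x y => x.size + y.size + 1

/-- Left subtree (`nil` for `nil`). -/
def head : Data → Data
  | nil => nil
  | cons x _ => x

/-- Right subtree (`nil` for `nil`). -/
def tail : Data → Data
  | nil => nil
  | cons _ y => y

/-- Natural numbers in unary. -/
def ofNat : ℕ → Data
  | 0 => nil
  | n + 1 => cons nil (ofNat n)

/-- Booleans: `false` is `nil`, `true` is the tree with one inner node. -/
def ofBool : Bool → Data
  | false => nil
  | true => cons nil nil

/-- Lists, given an encoding of the entries. -/
def ofList {α : Type} (f : α → Data) : List α → Data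
  | [] => nil
  | x :: xs => cons (f x) (ofList f xs)

end Data

/-- Programs. A program maps a tree to a tree and may run forever. -/
inductive Prog : Type
  /-- the input itself -/
  | arg : Prog
  /-- the constant `nil` -/
  | nil : Prog
  /-- left subtree of the input -/
  | head : Prog
  /-- right subtree of the input -/
  | tail : Prog
  /-- the tree whose subtrees are the outputs of the two programs on the input -/
  | cons : Prog → Prog → Prog
  /-- run the first program, then the second one on its output -/
  | seq : Prog → Prog → Prog
  /-- run the first program as a test; continue on the input with the second program
  if the test gives `nil`, and with the third one otherwise -/
  | ite : Prog → Prog → Prog → Prog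
  /-- `loop p f` replaces the input `x` by `f x` as long as `p x` is not `nil` -/
  | loop : Prog → Prog → Prog

/-- `Eval P x y t`: the program `P` halts on input `x` with output `y` after `t` steps.
Every elementary operation (copying a reference, taking a subtree, joining two trees, transferring
control, testing for `nil`) is one step. -/
inductive Eval : Prog → Data → Data → ℕ → Prop
  | arg (x : Data) : Eval Prog.arg x x 1
  | nil (x : Data) : Eval Prog.nil x Data.nil 1
  | head (x : Data) : Eval Prog.head x x.head 1
  | tail (x : Data) : Eval Prog.tail x x.tail 1
  | cons {f g : Prog} {x y z : Data} {s t : ℕ} :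
      Eval f x y s → Eval g x z t → Eval (Prog.cons f g) x (Data.cons y z) (s + t + 1)
  | seq {f g : Prog} {x y z : Data} {s t : ℕ} :
      Eval f x y s → Eval g y z t → Eval (Prog.seq f g) x z (s + t + 1)
  | ite_nil {p f g : Prog} {x y : Data} {s t : ℕ} :
      Eval p x Data.nil s → Eval f x y t → Eval (Prog.ite p f g) x y (s + t + 1)
  | ite_cons {p f g : Prog} {x u v y : Data} {s t : ℕ} :
      Eval p x (Data.cons u v) s → Eval g x y t → Eval (Prog.ite p f g) x y (s + t + 1)
  | loop_done {p f : Prog} {x : Data} {s : ℕ} :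
      Eval p x Data.nil s → Eval (Prog.loop p f) x x (s + 1)
  | loop_step {p f : Prog} {x u v y z : Data} {s t w : ℕ} :
      Eval p x (Data.cons u v) s → Eval f x y t → Eval (Prog.loop p f) y z w →
      Eval (Prog.loop p f) x z (s + t + w + 1)

/-- On input `x`, the program `P` computes `y` and writes it out node by node, all within time `T`.
(The output is charged by its full size, so that shared subtrees give no advantage.) -/
def Prog.OutputsIn (P : Prog) (x y : Data) (T : ℕ) : Prop :=
  ∃ t, Eval P x y t ∧ t + y.size ≤ T

/-- The program `R` computes the function `r : ℕ → ℕ`, within time `t n` on each `n`. -/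
def Prog.ComputesIn (R : Prog) (r t : ℕ → ℕ) : Prop :=
  ∀ n, R.OutputsIn (Data.ofNat n) (Data.ofNat (r n)) (t n)

/-! ### 3-SAT -/

/-- A literal over the variables `Fin n`: a variable, positive (`sign = true`) or negated. -/
structure Literal (n : ℕ) : Type where
  var : Fin n
  sign : Bool

/-- A 3-CNF formula over the variables `Fin n`: a list of clauses of at most three literals. -/
structure ThreeCNF (n : ℕ) : Type where
  clauses : List (List (Literal n))
  length_le : ∀ C ∈ clauses, C.length ≤ 3

namespace ThreeCNF

variable {n : ℕ}

/-- Some assignment makes at least one literal of every clause true. -/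
def Satisfiable (φ : ThreeCNF n) : Prop :=
  ∃ v : Fin n → Bool, ∀ C ∈ φ.clauses, ∃ l ∈ C, v l.var = l.sign

/-- At most `c * n` clauses. -/
def Sparse (c : ℕ) (φ : ThreeCNF n) : Prop :=
  φ.clauses.length ≤ c * n

/-- The formula as input of a program: the number of variables and the list of clauses. -/
def encode (φ : ThreeCNF n) : Data :=
  Data.cons (Data.ofNat n)
    (Data.ofList
      (Data.ofList fun l : Literal n => Data.cons (Data.ofBool l.sign) (Data.ofNat l.var))
      φ.clauses)

end ThreeCNF

/-! ### Set packing -/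

/-- An instance of parameterized set packing: a universe `{0, …, size - 1}`, a family of subsets,
and the parameter. -/
structure SetPacking : Type where
  size : ℕ
  family : Finset (Finset (Fin size))
  param : ℕ

namespace SetPacking

/-- There are `k` pairwise disjoint members of the family. -/
def HasPacking (I : SetPacking) (k : ℕ) : Prop :=
  ∃ A : Finset (Finset (Fin I.size)), A ⊆ I.family ∧ A.card = k ∧
    (A : Set (Finset (Fin I.size))).PairwiseDisjoint id

/-- The tree `d` describes `I`: universe size, parameter, and an explicit listing of the sets of
the family, each set once and given by a listing of its elements, each element once. -/
def EncodedBy (I : SetPacking) (d : Data) : Prop :=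
  ∃ L : List (List (Fin I.size)),
    (∀ s ∈ L, s.Nodup) ∧ (L.map List.toFinset).Nodup ∧
    (L.map List.toFinset).toFinset = I.family ∧
    d = Data.cons (Data.ofNat I.size) (Data.cons (Data.ofNat I.param)
      (Data.ofList (Data.ofList fun i : Fin I.size => Data.ofNat i) L))

end SetPacking

/-! The clauses are cut into `r` groups of at most c(⌊n/r⌋ + 1) clauses. A group involves O(n/r)
variables, so it has 2^{O(n/r)} partial assignments, and each of them becomes a set. An `r`-packing
must amount to one satisfying assignment per group, all of them consistent. Three devices enforce
this. Every set of group i contains the element `groupElt` of i, so a packing uses each group at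
most once, hence exactly once. A set whose assignment violates its group contains all elements
`groupElt`, so it meets every other set and is useless as soon as r ≥ 2. For a variable x, an
ordered pair (i, j) of groups and a sign s, the element `varElt` lies in the sets of group i with x
= s and in those of group j with x = ¬s; sets of two different groups share such an element exactly
when their assignments disagree. This makes 2nr² + r elements. Correctness is
`exists_packing_of_satisfiable` and `satisfiable_of_exists_packing`.

Each group also receives the first ⌊n/r⌋ + 1 variables. This padding forces at least r·2^{n/r} sets
even for formulas with few clauses (`le_length_packingSets`), and it gives all groups a common
variable, which keeps sets of different groups distinct. The upper bound is `length_packingSets_le`;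
compactness follows by taking logarithms.

For the running time, `PolyTime` is a calculus of uniformly computable families of trees, closed
under pairing, branching and bounded iteration. The definitions of the reduction are translated into
it one by one, with bound 2^⌊n/r⌋·nr, and `exists_prog` collects the result. -/

/-! ### Polynomial bounds. -/

/-- `f` is bounded by a polynomial in `B`. -/
def PolyBdd {ι : Type} (B f : ι → ℕ) : Prop :=
  ∃ k, ∀ i, f i ≤ (B i + 2) ^ k

namespace PolyBdd

variable {ι κ : Type} {B f g : ι → ℕ}

theorem mono (h : PolyBdd B g) (hfg : ∀ i, f i ≤ g i) : PolyBdd B f :=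
  let ⟨k, hk⟩ := h
  ⟨k, fun i => (hfg i).trans (hk i)⟩

/-- The base `B i + 2` is at least 2, so the exponent `c` suffices by c < 2^c. The same shift
absorbs the factor 2 in `add`. -/
theorem const (c : ℕ) : PolyBdd B fun _ => c :=
  ⟨c, fun i => Nat.lt_two_pow_self.le.trans (Nat.pow_le_pow_left (by omega) c)⟩

theorem self : PolyBdd B B :=
  ⟨1, fun i => by simp⟩

theorem mul (hf : PolyBdd B f) (hg : PolyBdd B g) : PolyBdd B fun i => f i * g i := by
  obtain ⟨k, hk⟩ := hf
  obtain ⟨l, hl⟩ := hg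
  exact ⟨k + l, fun i => by rw [pow_add]; exact Nat.mul_le_mul (hk i) (hl i)⟩

theorem add (hf : PolyBdd B f) (hg : PolyBdd B g) : PolyBdd B fun i => f i + g i := by
  obtain ⟨k, hk⟩ := hf
  obtain ⟨l, hl⟩ := hg
  refine ⟨k + l + 1, fun i => ?_⟩
  have h1 : (B i + 2) ^ k ≤ (B i + 2) ^ (k + l) := Nat.pow_le_pow_right (by omega) (by omega)
  have h2 : (B i + 2) ^ l ≤ (B i + 2) ^ (k + l) := Nat.pow_le_pow_right (by omega) (by omega)
  have h3 : (B i + 2) ^ (k + l) * 2 ≤ (B i + 2) ^ (k + l + 1) := by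
    rw [pow_succ (B i + 2) (k + l)]
    exact Nat.mul_le_mul_left _ (by omega)
  have h4 := hk i
  have h5 := hl i
  show f i + g i ≤ _
  omega

theorem pow (hf : PolyBdd B f) (m : ℕ) : PolyBdd B fun i => f i ^ m := by
  induction m with
  | zero => simpa using const 1
  | succ m ih => simpa only [pow_succ] using ih.mul hf

theorem comp (hf : PolyBdd B f) (u : κ → ι) :
    PolyBdd (fun j => B (u j)) fun j => f (u j) :=
  let ⟨k, hk⟩ := hf
  ⟨k, fun j => hk (u j)⟩

end PolyBdd

/-! ### Sizes of encoded numbers and lists. -/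

namespace Data

theorem size_head_le (x : Data) : x.head.size ≤ x.size := by
  cases x <;> simp [size, head]; omega

theorem size_tail_le (x : Data) : x.tail.size ≤ x.size := by
  cases x <;> simp [size, tail]; omega

theorem size_ofNat (n : ℕ) : (ofNat n).size = 2 * n + 1 := by
  induction n with
  | zero => rfl
  | succ n ih => simp only [ofNat, size, ih]; omega

theorem ofNat_eq_ofList (n : ℕ) :
    ofNat n = ofList (fun _ : Unit => nil) (List.replicate n ()) := by
  induction n with
  | zero => rfl
  | succ n ih => simp only [ofNat, ih, List.replicate_succ, ofList]

theorem tail_ofNat (n : ℕ) : (ofNat n).tail = ofNat (n - 1) := by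
  cases n <;> rfl

variable {α β : Type} (e : α → Data)

theorem length_le_size_ofList (l : List α) : l.length ≤ (ofList e l).size := by
  induction l with
  | nil => simp
  | cons a l ih => simp only [ofList, size, List.length_cons]; omega

theorem size_le_size_ofList {a : α} {l : List α} (h : a ∈ l) :
    (e a).size ≤ (ofList e l).size := by
  induction l with
  | nil => simp at h
  | cons b l ih =>
    simp only [ofList, size]
    rcases List.mem_cons.1 h with rfl | h
    · omega
    · have := ih h
      omega

theorem size_ofList_le {M : ℕ} {l : List α} (h : ∀ a ∈ l, (e a).size ≤ M) :
    (ofList e l).size ≤ l.length * (M + 1) + 1 := by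
  induction l with
  | nil => simp [ofList, size]
  | cons b l ih =>
    have h1 := h b (by simp)
    have h2 := ih fun a ha => h a (by simp [ha])
    simp only [ofList, size, List.length_cons, Nat.succ_mul]
    omega

theorem size_ofList_append (l l' : List α) :
    (ofList e (l ++ l')).size + 1 = (ofList e l).size + (ofList e l').size := by
  induction l with
  | nil => simp only [List.nil_append, ofList, size]; omega
  | cons a l ih => simp only [List.cons_append, ofList, size]; omega

theorem size_ofList_sublist {l l' : List α} (h : l.Sublist l') :
    (ofList e l).size ≤ (ofList e l').size := by
  induction h with
  | slnil => exact le_rfl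
  | cons a _ ih => simp only [ofList, size]; omega
  | cons_cons a _ ih => simp only [ofList, size]; omega

theorem size_ofList_flatten (l : List (List α)) :
    (ofList e l.flatten).size ≤ (ofList (ofList e) l).size := by
  induction l with
  | nil => exact le_rfl
  | cons a l ih =>
    have := size_ofList_append e a l.flatten
    simp only [List.flatten_cons, ofList, size]
    omega

theorem ofList_map (f : β → α) (l : List β) : ofList e (l.map f) = ofList (fun b => e (f b)) l := by
  induction l with
  | nil => rfl
  | cons a l ih => simp only [List.map_cons, ofList, ih]

theorem ofList_congr {e e' : α → Data} {l : List α} (h : ∀ a ∈ l, e a = e' a) :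
    ofList e l = ofList e' l := by
  induction l with
  | nil => rfl
  | cons a l ih =>
    simp only [ofList, h a (by simp), ih fun b hb => h b (by simp [hb])]

theorem tail_ofList (l : List α) : (ofList e l).tail = ofList e l.tail := by
  cases l <;> rfl

/-- Whether a tree is empty. -/
def isNil : Data → Bool
  | nil => true
  | cons _ _ => false

end Data

/-! ### A calculus of polynomial-time programs. -/

/-- One program maps `x i` to `y i` for all `i`, in time polynomial in `B i`; the size of `y i` is
polynomial in `B i` as well. -/
def PolyTime {ι : Type} (B : ι → ℕ) (x y : ι → Data) : Prop :=
  (∃ (P : Prog) (τ : ι → ℕ), PolyBdd B τ ∧ ∀ i, ∃ t ≤ τ i, Eval P (x i) (y i) t) ∧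
    PolyBdd B fun i => (y i).size

/-- Iteration over a list: `L` computes the list, `A` the initial state, and `S` the next state from
the current entry, the state and the input. -/
def Prog.fold (L A S : Prog) : Prog :=
  .seq (.seq (.cons L (.cons A .arg))
      (.loop .head (.cons (.seq .head .tail)
        (.cons (.seq (.cons (.seq .head .head) .tail) S) (.seq .tail .tail)))))
    (.seq .tail .head)

/-- The loop state is (remaining list, accumulator, input). Each round removes one entry and costs
one run of `S` plus fewer than 20 steps of bookkeeping. The induction shifts the sequence `A` by
one. -/
theorem Eval.fold_loop {α : Type} (e : α → Data) {S : Prog} {x : Data} {M : ℕ} (l : List α) :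
    ∀ A : ℕ → Data,
      (∀ (j : ℕ) (hj : j < l.length),
        ∃ t ≤ M, Eval S (.cons (e l[j]) (.cons (A j) x)) (A (j + 1)) t) →
      ∃ t ≤ l.length * (M + 20) + 2,
        Eval (.loop .head (.cons (.seq .head .tail)
          (.cons (.seq (.cons (.seq .head .head) .tail) S) (.seq .tail .tail))))
          (.cons (Data.ofList e l) (.cons (A 0) x))
          (.cons .nil (.cons (A l.length) x)) t := by
  induction l with
  | nil =>
    intro A _
    exact ⟨2, by simp, .loop_done (.head _)⟩
  | cons a l ih =>
    intro A h
    obtain ⟨t, ht, hS⟩ := h 0 (by simp)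
    obtain ⟨w, hw, hL⟩ := ih (fun j => A (j + 1)) fun j hj =>
      h (j + 1) (by simpa using hj)
    refine ⟨_, ?_, .loop_step (.head _) (.cons (.seq (.head _) (.tail _))
      (.cons (.seq (.cons (.seq (.head _) (.head _)) (.tail _)) hS)
        (.seq (.tail _) (.tail _)))) hL⟩
    simp only [List.length_cons, Nat.succ_mul]
    omega

namespace PolyTime

variable {ι κ α β : Type} {B : ι → ℕ} {x y z w : ι → Data}

theorem congr (h : PolyTime B x y) (hyz : ∀ i, y i = z i) : PolyTime B x z := by
  rwa [show z = y from funext fun i => (hyz i).symm]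

/-- Inside a loop body the index also records the iteration; this transports programs for the outer
input to that larger index type. -/
theorem reindex (h : PolyTime B x y) (u : κ → ι) :
    PolyTime (fun j => B (u j)) (fun j => x (u j)) fun j => y (u j) := by
  obtain ⟨⟨P, τ, hτ, hP⟩, hy⟩ := h
  exact ⟨⟨P, _, hτ.comp u, fun j => hP (u j)⟩, hy.comp u⟩

theorem comp (hy : PolyTime B x y) (hz : PolyTime B y z) : PolyTime B x z := by
  obtain ⟨⟨P, τ, hτ, hP⟩, -⟩ := hy
  obtain ⟨⟨Q, σ, hσ, hQ⟩, hs⟩ := hz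
  refine ⟨⟨.seq P Q, _, (hτ.add hσ).add (.const 1), fun i => ?_⟩, hs⟩
  obtain ⟨t, ht, h1⟩ := hP i
  obtain ⟨s, hs, h2⟩ := hQ i
  exact ⟨_, by omega, .seq h1 h2⟩

theorem arg (hx : PolyBdd B fun i => (x i).size) : PolyTime B x x :=
  ⟨⟨.arg, _, .const 1, fun _ => ⟨1, le_rfl, .arg _⟩⟩, hx⟩

theorem nil : PolyTime B x fun _ => .nil :=
  ⟨⟨.nil, _, .const 1, fun _ => ⟨1, le_rfl, .nil _⟩⟩, .const 1⟩

theorem head (hy : PolyTime B x y) : PolyTime B x fun i => (y i).head :=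
  hy.comp ⟨⟨.head, _, .const 1, fun _ => ⟨1, le_rfl, .head _⟩⟩,
    hy.2.mono fun i => (y i).size_head_le⟩

theorem tail (hy : PolyTime B x y) : PolyTime B x fun i => (y i).tail :=
  hy.comp ⟨⟨.tail, _, .const 1, fun _ => ⟨1, le_rfl, .tail _⟩⟩,
    hy.2.mono fun i => (y i).size_tail_le⟩

theorem fst (h : PolyTime B x fun i => .cons (y i) (z i)) : PolyTime B x y :=
  h.head

theorem snd (h : PolyTime B x fun i => .cons (y i) (z i)) : PolyTime B x z :=
  h.tail

theorem cons (hy : PolyTime B x y) (hz : PolyTime B x z) :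
    PolyTime B x fun i => .cons (y i) (z i) := by
  obtain ⟨⟨P, τ, hτ, hP⟩, hy⟩ := hy
  obtain ⟨⟨Q, σ, hσ, hQ⟩, hz⟩ := hz
  refine ⟨⟨.cons P Q, _, (hτ.add hσ).add (.const 1), fun i => ?_⟩, (hy.add hz).add (.const 1)⟩
  obtain ⟨t, ht, h1⟩ := hP i
  obtain ⟨s, hs, h2⟩ := hQ i
  exact ⟨_, by omega, .cons h1 h2⟩

theorem ifNil (hw : PolyTime B x w) (hy : PolyTime B x y) (hz : PolyTime B x z) :
    PolyTime B x fun i => bif (w i).isNil then y i else z i := by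
  obtain ⟨⟨P, τ, hτ, hP⟩, -⟩ := hw
  obtain ⟨⟨Q, σ, hσ, hQ⟩, hy⟩ := hy
  obtain ⟨⟨R, ρ, hρ, hR⟩, hz⟩ := hz
  refine ⟨⟨.ite P Q R, _, ((hτ.add hσ).add hρ).add (.const 1), fun i => ?_⟩,
    (hy.add hz).mono fun i => ?_⟩
  · obtain ⟨t, ht, h1⟩ := hP i
    obtain ⟨s, hs, h2⟩ := hQ i
    obtain ⟨q, hq, h3⟩ := hR i
    beta_reduce
    rcases h : w i with _ | ⟨u, v⟩
    · rw [h] at h1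
      exact ⟨t + s + 1, by omega, .ite_nil h1 h2⟩
    · rw [h] at h1
      exact ⟨t + q + 1, by omega, .ite_cons h1 h3⟩
  · beta_reduce
    cases (w i).isNil
    · exact Nat.le_add_left _ _
    · exact Nat.le_add_right _ _

theorem const : ∀ d : Data, PolyTime B x fun _ => d
  | .nil => nil
  | .cons d e => (const d).cons (const e)

/-! ### Booleans -/

theorem isNil (hy : PolyTime B x y) : PolyTime B x fun i => .ofBool (y i).isNil :=
  (hy.ifNil (const (.ofBool true)) (const (.ofBool false))).congr fun i => by
    cases (y i).isNil <;> rfl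

theorem cond {b : ι → Bool} (hb : PolyTime B x fun i => .ofBool (b i)) (hy : PolyTime B x y)
    (hz : PolyTime B x z) : PolyTime B x fun i => bif b i then y i else z i :=
  (hb.ifNil hz hy).congr fun i => by cases b i <;> rfl

theorem not {b : ι → Bool} (hb : PolyTime B x fun i => .ofBool (b i)) :
    PolyTime B x fun i => .ofBool (!b i) :=
  hb.isNil.congr fun i => by cases b i <;> rfl

theorem and {b c : ι → Bool} (hb : PolyTime B x fun i => .ofBool (b i))
    (hc : PolyTime B x fun i => .ofBool (c i)) : PolyTime B x fun i => .ofBool (b i && c i) :=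
  (hb.cond hc (const (.ofBool false))).congr fun i => by cases b i <;> rfl

theorem or {b c : ι → Bool} (hb : PolyTime B x fun i => .ofBool (b i))
    (hc : PolyTime B x fun i => .ofBool (c i)) : PolyTime B x fun i => .ofBool (b i || c i) :=
  (hb.cond (const (.ofBool true)) hc).congr fun i => by cases b i <;> rfl

theorem beq_bool {b c : ι → Bool} (hb : PolyTime B x fun i => .ofBool (b i))
    (hc : PolyTime B x fun i => .ofBool (c i)) : PolyTime B x fun i => .ofBool (b i == c i) :=
  (hb.cond hc hc.not).congr fun i => by cases b i <;> cases c i <;> rfl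

/-! ### Loops -/

/-- A polynomial bound `G` on all intermediate states is indispensable, because iterating a
polynomial-time step may blow up the state. With it, the premise of `hS` (the loop state computed
from itself) can be discharged once here, and callers obtain the parts of the state as projections
of it. -/
theorem fold {e : α → Data} {l : ι → List α} {A : ι → ℕ → Data} {G : ι → ℕ}
    (hx : PolyTime B x x) (hl : PolyTime B x fun i => .ofList e (l i))
    (hG : PolyBdd B G) (hA : ∀ i, ∀ j ≤ (l i).length, (A i j).size ≤ G i)
    (h0 : PolyTime B x fun i => A i 0)
    (hS : PolyTime (ι := (i : ι) × Fin (l i).length) (fun p => B p.1)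
        (fun p => .cons (e (l p.1)[p.2]) (.cons (A p.1 p.2) (x p.1)))
        (fun p => .cons (e (l p.1)[p.2]) (.cons (A p.1 p.2) (x p.1))) →
      PolyTime (ι := (i : ι) × Fin (l i).length) (fun p => B p.1)
        (fun p => .cons (e (l p.1)[p.2]) (.cons (A p.1 p.2) (x p.1)))
        fun p => A p.1 (p.2 + 1)) :
    PolyTime B x fun i => A i (l i).length := by
  have hlen : PolyBdd B fun i => (l i).length := hl.2.mono fun i => Data.length_le_size_ofList _ _
  have hE : PolyBdd (ι := (i : ι) × Fin (l i).length) (fun p => B p.1)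
      fun p => (Data.cons (e (l p.1)[p.2]) (.cons (A p.1 p.2) (x p.1))).size := by
    refine (((hl.2.add hG).add hx.2).add (.const 2)).comp Sigma.fst |>.mono fun ⟨i, j, hj⟩ => ?_
    have h1 := hA i j hj.le
    have h2 := Data.size_le_size_ofList e (List.getElem_mem hj)
    simp only [Data.size, Fin.getElem_fin]
    omega
  obtain ⟨⟨L, τ, hτ, hL⟩, -⟩ := hl
  obtain ⟨⟨A₀, σ, hσ, hA₀⟩, -⟩ := h0
  obtain ⟨⟨S, ρ, ⟨k, hk⟩, hS⟩, -⟩ := hS (arg hE)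
  have hB : PolyBdd B fun i => (B i + 2) ^ k := ⟨k, fun _ => le_rfl⟩
  refine ⟨⟨.fold L A₀ S, _, ((hτ.add hσ).add (hlen.mul (hB.add (.const 20)))).add (.const 20),
    fun i => ?_⟩, hG.mono fun i => hA i _ le_rfl⟩
  obtain ⟨t, ht, h1⟩ := hL i
  obtain ⟨s, hs, h2⟩ := hA₀ i
  obtain ⟨q, hq, h3⟩ := Eval.fold_loop e (S := S) (x := x i) (M := (B i + 2) ^ k) (l i) (A i)
    fun j hj => by
      obtain ⟨q, hq, h3⟩ := hS ⟨i, j, hj⟩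
      exact ⟨q, hq.trans (hk ⟨i, j, hj⟩), h3⟩
  exact ⟨_, by omega, .seq (.seq (.cons h1 (.cons h2 (.arg _))) h3) (.seq (.tail _) (.head _))⟩

/-- A unary number is a list of empty trees, so recursion on it is a fold that ignores the entries.
-/
theorem natRec {F : ι → ℕ → Data} {n G : ι → ℕ} (hx : PolyTime B x x)
    (hn : PolyTime B x fun i => .ofNat (n i))
    (hG : PolyBdd B G) (hF : ∀ i, ∀ j ≤ n i, (F i j).size ≤ G i)
    (h0 : PolyTime B x fun i => F i 0)
    (hS : PolyTime (ι := (i : ι) × Fin (n i)) (fun p => B p.1)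
        (fun p => .cons (F p.1 p.2) (x p.1)) (fun p => .cons (F p.1 p.2) (x p.1)) →
      PolyTime (ι := (i : ι) × Fin (n i)) (fun p => B p.1)
        (fun p => .cons (F p.1 p.2) (x p.1)) fun p => F p.1 (p.2 + 1)) :
    PolyTime B x fun i => F i (n i) := by
  have h := fold (l := fun i => List.replicate (n i) ()) (A := F) hx
    (hn.congr fun i => Data.ofNat_eq_ofList _) hG (by simpa using hF) h0 fun harg => ?_
  · simpa using h
  · have hE : PolyBdd (ι := (i : ι) × Fin (n i)) (fun p => B p.1)
        fun p => (Data.cons (F p.1 p.2) (x p.1)).size := by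
      refine ((hG.add hx.2).add (.const 1)).comp Sigma.fst |>.mono fun ⟨i, j, hj⟩ => ?_
      have h1 := hF i j hj.le
      simp only [Data.size]
      omega
    exact harg.snd.comp ((hS (arg hE)).reindex
      fun p : (i : ι) × Fin (List.replicate (n i) ()).length => ⟨p.1, p.2.cast (by simp)⟩)

theorem reverse {e : α → Data} {l : ι → List α} (hx : PolyTime B x x)
    (hl : PolyTime B x fun i => .ofList e (l i)) :
    PolyTime B x fun i => .ofList e (l i).reverse := by
  have hrev : ∀ l : List α, (Data.ofList e l.reverse).size = (Data.ofList e l).size := by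
    intro l
    induction l with
    | nil => rfl
    | cons a l ih =>
      have := Data.size_ofList_append e l.reverse [a]
      simp only [List.reverse_cons, Data.ofList, Data.size] at this ⊢
      omega
  have h := fold (A := fun i j => .ofList e ((l i).take j).reverse) hx hl hl.2
    (fun i j _ => by
      rw [hrev]
      exact Data.size_ofList_sublist e (List.take_sublist _ _)) nil
    fun harg => (harg.fst.cons harg.snd.fst).congr fun ⟨i, j, hj⟩ => by
      simp only [Fin.getElem_fin, List.take_succ_eq_append_getElem hj, List.reverse_append,
        List.reverse_singleton, List.singleton_append, Data.ofList]
  simpa using h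

/-- Folding over the reversed list builds `F` along longer and longer suffixes, which matches
structural recursion on lists. -/
theorem foldr {e : α → Data} {l : ι → List α} {F : ι → List α → Data} {G : ι → ℕ}
    (hx : PolyTime B x x) (hl : PolyTime B x fun i => .ofList e (l i))
    (hG : PolyBdd B G) (hF : ∀ i s, s <:+ l i → (F i s).size ≤ G i)
    (h0 : PolyTime B x fun i => F i [])
    (hS : PolyTime (ι := {p : ι × α × List α // p.2.1 :: p.2.2 <:+ l p.1}) (fun p => B p.1.1)
        (fun p => .cons (e p.1.2.1) (.cons (F p.1.1 p.1.2.2) (x p.1.1)))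
        (fun p => .cons (e p.1.2.1) (.cons (F p.1.1 p.1.2.2) (x p.1.1))) →
      PolyTime (ι := {p : ι × α × List α // p.2.1 :: p.2.2 <:+ l p.1}) (fun p => B p.1.1)
        (fun p => .cons (e p.1.2.1) (.cons (F p.1.1 p.1.2.2) (x p.1.1)))
        fun p => F p.1.1 (p.1.2.1 :: p.1.2.2)) :
    PolyTime B x fun i => F i (l i) := by
  have hE : PolyBdd (ι := {p : ι × α × List α // p.2.1 :: p.2.2 <:+ l p.1}) (fun p => B p.1.1)
      fun p => (Data.cons (e p.1.2.1) (.cons (F p.1.1 p.1.2.2) (x p.1.1))).size := by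
    refine (((hl.2.add hG).add hx.2).add (.const 2)).comp
      (fun p : {p : ι × α × List α // p.2.1 :: p.2.2 <:+ l p.1} => p.1.1) |>.mono ?_
    rintro ⟨⟨i, a, s⟩, h⟩
    have h1 := hF i s ((List.suffix_cons a s).trans h)
    have h2 : (e a).size ≤ (Data.ofList e (l i)).size :=
      Data.size_le_size_ofList e (h.subset List.mem_cons_self)
    simp only [Data.size]
    omega
  have h := fold (l := fun i => (l i).reverse)
    (A := fun i j => F i ((l i).drop ((l i).length - j))) hx (hx.reverse hl) hG
    (fun i j _ => hF i _ (List.drop_suffix _ _)) (by simpa using h0) fun harg => ?_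
  · simpa using h
  · have key : ∀ (i : ι) (j : ℕ) (hj : j < (l i).reverse.length),
        (l i).drop ((l i).length - (j + 1)) =
          (l i).reverse[j] :: (l i).drop ((l i).length - j) := by
      intro i j hj
      have hj' : j < (l i).length := by simpa using hj
      rw [List.getElem_reverse, List.drop_eq_getElem_cons (by omega)]
      congr 2 <;> omega
    have hu : ∀ p : (i : ι) × Fin (l i).reverse.length,
        (l p.1).reverse[p.2] :: (l p.1).drop ((l p.1).length - p.2) <:+ l p.1 := by
      rintro ⟨i, j, hj⟩
      simp only [Fin.getElem_fin]
      rw [← key i j hj]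
      exact List.drop_suffix _ _
    refine ((hS (arg hE)).reindex fun p : (i : ι) × Fin (l i).reverse.length =>
      ⟨(p.1, (l p.1).reverse[p.2], (l p.1).drop ((l p.1).length - p.2)), hu p⟩).congr ?_
    rintro ⟨i, j, hj⟩
    simp only [key i j hj, Fin.getElem_fin]

/-! ### Arithmetic -/

theorem succ {n : ι → ℕ} (hn : PolyTime B x fun i => .ofNat (n i)) :
    PolyTime B x fun i => .ofNat (n i + 1) :=
  nil.cons hn

theorem ofNat_add {m n : ι → ℕ} (hx : PolyTime B x x) (hm : PolyTime B x fun i => .ofNat (m i))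
    (hn : PolyTime B x fun i => .ofNat (n i)) : PolyTime B x fun i => .ofNat (m i + n i) :=
  natRec (F := fun i j => .ofNat (m i + j)) hx hn (hm.2.add hn.2)
    (fun i j hj => by simp only [Data.size_ofNat]; omega) hm fun harg => harg.fst.succ

theorem ofNat_mul {m n : ι → ℕ} (hx : PolyTime B x x) (hm : PolyTime B x fun i => .ofNat (m i))
    (hn : PolyTime B x fun i => .ofNat (n i)) : PolyTime B x fun i => .ofNat (m i * n i) :=
  natRec (F := fun i j => .ofNat (m i * j)) hx hn (hm.2.mul hn.2)
    (fun i j hj => by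
      simp only [Data.size_ofNat]
      nlinarith [Nat.mul_le_mul_left (m i) hj]) nil
    fun harg => harg.ofNat_add harg.fst (harg.snd.comp (hm.reindex Sigma.fst))

theorem ofNat_sub {m n : ι → ℕ} (hx : PolyTime B x x) (hm : PolyTime B x fun i => .ofNat (m i))
    (hn : PolyTime B x fun i => .ofNat (n i)) : PolyTime B x fun i => .ofNat (m i - n i) :=
  natRec (F := fun i j => .ofNat (m i - j)) hx hn hm.2
    (fun i j hj => by simp only [Data.size_ofNat]; omega) hm fun harg =>
      harg.fst.tail.congr fun p => Data.tail_ofNat _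

theorem decide_le {m n : ι → ℕ} (hx : PolyTime B x x) (hm : PolyTime B x fun i => .ofNat (m i))
    (hn : PolyTime B x fun i => .ofNat (n i)) :
    PolyTime B x fun i => .ofBool (decide (m i ≤ n i)) :=
  (hx.ofNat_sub hm hn).isNil.congr fun i => by
    rcases h : m i - n i with _ | k
    · simp [Data.ofNat, Data.isNil, Nat.sub_eq_zero_iff_le.1 h]
    · simp [Data.ofNat, Data.isNil, show ¬ m i ≤ n i by omega]

theorem beq_nat {m n : ι → ℕ} (hx : PolyTime B x x) (hm : PolyTime B x fun i => .ofNat (m i))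
    (hn : PolyTime B x fun i => .ofNat (n i)) : PolyTime B x fun i => .ofBool (m i == n i) :=
  ((hx.decide_le hm hn).and (hx.decide_le hn hm)).congr fun i => by
    congr 1
    rw [Bool.eq_iff_iff]
    simp only [Bool.and_eq_true, decide_eq_true_eq, beq_iff_eq]
    omega

/-! ### Lists -/

theorem append {e : α → Data} {l l' : ι → List α} (hx : PolyTime B x x)
    (hl : PolyTime B x fun i => .ofList e (l i)) (hl' : PolyTime B x fun i => .ofList e (l' i)) :
    PolyTime B x fun i => .ofList e (l i ++ l' i) :=
  foldr (F := fun i s => .ofList e (s ++ l' i)) hx hl (hl.2.add hl'.2)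
    (fun i s hs => by
      have h1 := Data.size_ofList_append e s (l' i)
      have h2 := Data.size_ofList_sublist e hs.sublist
      beta_reduce
      omega) hl' fun harg => harg.fst.cons harg.snd.fst

theorem flatten {e : α → Data} {l : ι → List (List α)} (hx : PolyTime B x x)
    (hl : PolyTime B x fun i => .ofList (.ofList e) (l i)) :
    PolyTime B x fun i => .ofList e (l i).flatten :=
  foldr (F := fun _ s => .ofList e s.flatten) hx hl hl.2
    (fun _ _ hs => (Data.size_ofList_flatten e _).trans (Data.size_ofList_sublist _ hs.sublist))
    nil fun harg => harg.append harg.fst harg.snd.fst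

theorem length {e : α → Data} {l : ι → List α} (hx : PolyTime B x x)
    (hl : PolyTime B x fun i => .ofList e (l i)) : PolyTime B x fun i => .ofNat (l i).length :=
  foldr (F := fun i s => .ofNat s.length) hx hl ((hl.2.mul (.const 2)).add (.const 1))
    (fun i s hs => by
      have h1 := Data.length_le_size_ofList e (l i)
      have h2 := hs.length_le
      rw [Data.size_ofNat]
      beta_reduce
      omega) nil fun harg => harg.snd.fst.succ

theorem polyBdd_length {e : α → Data} {l : ι → List α}
    (hl : PolyTime B x fun i => .ofList e (l i)) : PolyBdd B fun i => (l i).length :=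
  hl.2.mono fun _ => Data.length_le_size_ofList _ _

theorem drop {e : α → Data} {l : ι → List α} {n : ι → ℕ} (hx : PolyTime B x x)
    (hn : PolyTime B x fun i => .ofNat (n i)) (hl : PolyTime B x fun i => .ofList e (l i)) :
    PolyTime B x fun i => .ofList e ((l i).drop (n i)) :=
  natRec (F := fun i j => .ofList e ((l i).drop j)) hx hn hl.2
    (fun _ _ _ => Data.size_ofList_sublist e (List.drop_sublist _ _)) hl fun harg =>
      harg.fst.tail.congr fun p => by rw [Data.tail_ofList, List.tail_drop]

theorem take {e : α → Data} {l : ι → List α} {n : ι → ℕ} (hx : PolyTime B x x)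
    (hn : PolyTime B x fun i => .ofNat (n i)) (hl : PolyTime B x fun i => .ofList e (l i)) :
    PolyTime B x fun i => .ofList e ((l i).take (n i)) :=
  (hx.reverse (hx.drop (hx.ofNat_sub (hx.length hl) hn) (hx.reverse hl))).congr fun i => by
    rw [← List.reverse_take, List.reverse_reverse]

/-- The tree `g i a` is computed in polynomial time from the entry `a` of `l i` and from `x i`. The
input is abstracted to a tree `x'` from which `a` and all that can be computed from `x i` can be
computed. -/
abbrev EntryPolyTime (B : ι → ℕ) (x : ι → Data) (e : α → Data) (l : ι → List α)
    (g : ι → α → Data) : Prop :=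
  ∀ x' : {p : ι × α // p.2 ∈ l p.1} → Data,
    PolyTime (fun p => B p.1.1) x' x' →
    PolyTime (fun p => B p.1.1) x' (fun p => e p.1.2) →
    (∀ y, PolyTime B x y → PolyTime (fun p => B p.1.1) x' fun p => y p.1.1) →
    PolyTime (fun p => B p.1.1) x' fun p => g p.1.1 p.1.2

theorem map {e : α → Data} {e' : β → Data} {l : ι → List α} {f : ι → α → β}
    (hx : PolyTime B x x) (hl : PolyTime B x fun i => .ofList e (l i))
    (hf : EntryPolyTime B x e l fun i a => e' (f i a)) :
    PolyTime B x fun i => .ofList e' ((l i).map (f i)) := by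
  have hE : PolyBdd (ι := {p : ι × α // p.2 ∈ l p.1}) (fun p => B p.1.1)
      fun p => (Data.cons (e p.1.2) (x p.1.1)).size := by
    refine ((hl.2.add hx.2).add (.const 1)).comp
      (fun p : {p : ι × α // p.2 ∈ l p.1} => p.1.1) |>.mono ?_
    rintro ⟨⟨i, a⟩, h⟩
    have h2 : (e a).size ≤ (Data.ofList e (l i)).size := Data.size_le_size_ofList e h
    simp only [Data.size]
    omega
  -- The abstract input is instantiated by the pair of the entry and the original input.
  have hf := hf _ (arg hE) (arg hE).fst fun y hy => (arg hE).snd.comp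
    (hy.reindex fun p : {p : ι × α // p.2 ∈ l p.1} => p.1.1)
  obtain ⟨k, hk⟩ := hf.2
  have hB : PolyBdd B fun i => (B i + 2) ^ k := ⟨k, fun _ => le_rfl⟩
  refine foldr (F := fun i s => .ofList e' (s.map (f i))) hx hl
    ((hl.polyBdd_length.mul (hB.add (.const 1))).add (.const 1)) (fun i s hs => ?_) nil
    fun harg => ?_
  · refine (Data.size_ofList_le e' (M := (B i + 2) ^ k) fun b hb => ?_).trans ?_
    · obtain ⟨a, ha, rfl⟩ := List.mem_map.1 hb
      exact hk ⟨(i, a), hs.subset ha⟩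
    · rw [List.length_map]
      gcongr
      exact hs.length_le
  · exact ((harg.fst.cons harg.snd.snd).comp (hf.reindex
      fun p : {p : ι × α × List α // p.2.1 :: p.2.2 <:+ l p.1} =>
        ⟨(p.1.1, p.1.2.1), p.2.subset List.mem_cons_self⟩)).cons harg.snd.fst

theorem flatMap {e : α → Data} {e' : β → Data} {l : ι → List α} {f : ι → α → List β}
    (hx : PolyTime B x x) (hl : PolyTime B x fun i => .ofList e (l i))
    (hf : EntryPolyTime B x e l fun i a => .ofList e' (f i a)) :
    PolyTime B x fun i => .ofList e' ((l i).flatMap (f i)) :=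
  (hx.flatten (hx.map hl hf)).congr fun i => by rw [List.flatMap_def]

theorem any {e : α → Data} {l : ι → List α} {f : ι → α → Bool}
    (hx : PolyTime B x x) (hl : PolyTime B x fun i => .ofList e (l i))
    (hf : EntryPolyTime B x e l fun i a => .ofBool (f i a)) :
    PolyTime B x fun i => .ofBool ((l i).any (f i)) := by
  have h := foldr (F := fun i s => .ofBool (s.any id)) hx (hx.map hl hf) (.const 3)
    (fun i s _ => by cases s.any id <;> simp [Data.ofBool, Data.size]) nil
    fun harg => harg.fst.or harg.snd.fst
  exact h.congr fun i => by rw [List.any_map]; rfl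

theorem all {e : α → Data} {l : ι → List α} {f : ι → α → Bool}
    (hx : PolyTime B x x) (hl : PolyTime B x fun i => .ofList e (l i))
    (hf : EntryPolyTime B x e l fun i a => .ofBool (f i a)) :
    PolyTime B x fun i => .ofBool ((l i).all (f i)) :=
  (hx.any (f := fun i a => !f i a) hl fun x' h ha up => (hf x' h ha up).not).not.congr fun i => by
    rw [List.all_eq_not_any_not]

theorem filter {e : α → Data} {l : ι → List α} {f : ι → α → Bool}
    (hx : PolyTime B x x) (hl : PolyTime B x fun i => .ofList e (l i))
    (hf : EntryPolyTime B x e l fun i a => .ofBool (f i a)) :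
    PolyTime B x fun i => .ofList e ((l i).filter (f i)) :=
  (hx.flatMap (e' := e) (f := fun i a => bif f i a then [a] else []) hl fun x' h ha up =>
    ((hf x' h ha up).cond (ha.cons nil) nil).congr fun p => by
      beta_reduce
      cases f p.1.1 p.1.2 <;> rfl).congr fun i => by
    congr 1
    induction l i with
    | nil => rfl
    | cons a l ih => cases h : f i a <;> simp [h, ih]

theorem range {n : ι → ℕ} (hx : PolyTime B x x) (hn : PolyTime B x fun i => .ofNat (n i)) :
    PolyTime B x fun i => .ofList .ofNat (List.range (n i)) := by
  -- `natRec` does not hand the iteration number to its body, so the state carries a counter next to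
  -- the list.
  have h := natRec (F := fun i j => .cons (.ofNat j) (.ofList .ofNat (List.range j).reverse)) hx hn
    ((hn.2.add (hn.2.mul (hn.2.add (.const 1)))).add (.const 2)) (fun i j hj => ?_) (nil.cons nil)
    fun harg => ?_
  · exact (hx.reverse h.snd).congr fun i => by rw [List.reverse_reverse]
  · have h1 := Data.size_ofList_le Data.ofNat (M := 2 * n i + 1) (l := (List.range j).reverse)
      fun a ha => by
        have : a < j := by simpa using ha
        rw [Data.size_ofNat]
        omega
    rw [List.length_reverse, List.length_range] at h1
    have h2 : j * (2 * n i + 1 + 1) ≤ (2 * n i + 1) * (2 * n i + 1 + 1) :=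
      Nat.mul_le_mul_right _ (by omega)
    simp only [Data.size, Data.size_ofNat]
    omega
  · exact (harg.fst.fst.succ.cons (harg.fst.fst.cons harg.fst.snd)).congr fun p => by
      simp [List.range_succ, Data.ofList]

end PolyTime

/-! ### The reduction, on lists of natural numbers -/

namespace Reduction

/-- Assignments to the variables in `V`, as lists of true literals. -/
def assignments : List ℕ → List (List (ℕ × Bool))
  | [] => [[]]
  | x :: V => (assignments V).map (fun α => (x, true) :: α) ++
      (assignments V).map fun α => (x, false) :: α

/-- Whether the variable `x` occurs in the list of clauses `G`. -/
def occurs (x : ℕ) (G : List (List (ℕ × Bool))) : Bool :=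
  G.any fun C => C.any fun l => l.1 == x

/-- Whether every clause in `G` has a literal in `α`. -/
def satisfies (α : List (ℕ × Bool)) (G : List (List (ℕ × Bool))) : Bool :=
  G.all fun C => C.any fun l => α.any fun m => m.1 == l.1 && m.2 == l.2

/-- The variables that belong to a group `G` of clauses: those occurring in it, and the first
`⌊n / r⌋ + 1` variables. -/
def groupVars (n r : ℕ) (G : List (List (ℕ × Bool))) : List ℕ :=
  (List.range n).filter fun x => decide (x * r ≤ n) || occurs x G

/-- The number of clauses in a group. -/
def groupSize (c n r : ℕ) : ℕ :=
  c * ((List.range (n + 1)).filter fun q => decide (q * r ≤ n)).length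

/-- The `i`-th group of clauses. -/
def group (c n r : ℕ) (cl : List (List (ℕ × Bool))) (i : ℕ) : List (List (ℕ × Bool)) :=
  (cl.drop (groupSize c n r * i)).take (groupSize c n r)

/-- The element that belongs to the variable `x`, the pair of groups `(i, j)` and the sign `s`.
It lies in the sets of group `i` for assignments that give `x` the value `s`, and in the sets of
group `j` for assignments that give `x` the value `!s`. -/
def varElt (r x i j : ℕ) (s : Bool) : ℕ :=
  ((x * r + i) * r + j) * 2 + bif s then 1 else 0

/-- The element that belongs to group `j`. -/
def groupElt (n r j : ℕ) : ℕ :=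
  n * r * r * 2 + j

/-- The set for the assignment `α` to the variables of the group `G` with index `i`. If `α` does not
satisfy `G`, then the set meets all other sets. -/
def assignmentSet (n r : ℕ) (G : List (List (ℕ × Bool))) (i : ℕ) (α : List (ℕ × Bool)) : List ℕ :=
  (α.flatMap fun m => (List.range r).flatMap fun j =>
    [varElt r m.1 i j m.2, varElt r m.1 j i (!m.2)]) ++
  bif satisfies α G then [groupElt n r i] else (List.range r).map fun j => groupElt n r j

/-- The sets of group `i`. -/
def groupSets (c n r : ℕ) (cl : List (List (ℕ × Bool))) (i : ℕ) : List (List ℕ) :=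
  (assignments (groupVars n r (group c n r cl i))).map fun α =>
    assignmentSet n r (group c n r cl i) i α

/-- All sets of the instance. -/
def packingSets (c n r : ℕ) (cl : List (List (ℕ × Bool))) : List (List ℕ) :=
  (List.range r).flatMap fun i => groupSets c n r cl i

/-- The size of the universe. -/
def universeSize (n r : ℕ) : ℕ :=
  n * r * r * 2 + r

/-- A literal as a tree. -/
def encodeLit (l : ℕ × Bool) : Data :=
  .cons (.ofBool l.2) (.ofNat l.1)

/-! ### Sizes of groups and numbers of assignments. -/

theorem length_assignments (V : List ℕ) : (assignments V).length = 2 ^ V.length := by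
  induction V with
  | nil => rfl
  | cons x V ih =>
    simp only [assignments, List.length_append, List.length_map, ih, List.length_cons, pow_succ]
    omega

theorem map_fst_of_mem_assignments {V : List ℕ} {α : List (ℕ × Bool)} (h : α ∈ assignments V) :
    α.map Prod.fst = V := by
  induction V generalizing α with
  | nil => simp_all [assignments]
  | cons x V ih =>
    simp only [assignments, List.mem_append, List.mem_map] at h
    rcases h with ⟨β, hβ, rfl⟩ | ⟨β, hβ, rfl⟩ <;> simp [ih hβ]

/-- Counting replaces division: the reduction obtains ⌊n/r⌋ + 1 with multiplication and comparison
only. -/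
theorem length_filter_mul_le {n r : ℕ} (hr : 0 < r) :
    ((List.range (n + 1)).filter fun q => decide (q * r ≤ n)).length = n / r + 1 := by
  have h : ∀ q, q * r ≤ n ↔ q < n / r + 1 := fun q => by
    rw [Nat.lt_succ_iff, Nat.le_div_iff_mul_le hr]
  have h1 : n / r ≤ n := Nat.div_le_self _ _
  rw [← List.toFinset_card_of_nodup (List.nodup_range.filter _)]
  have : ((List.range (n + 1)).filter fun q => decide (q * r ≤ n)).toFinset =
      Finset.range (n / r + 1) := by
    ext q
    simp only [List.mem_toFinset, List.mem_filter, List.mem_range, decide_eq_true_eq, h,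
      Finset.mem_range]
    omega
  rw [this, Finset.card_range]

theorem groupSize_eq (c : ℕ) {n r : ℕ} (hr : 0 < r) : groupSize c n r = c * (n / r + 1) := by
  rw [groupSize, length_filter_mul_le hr]

theorem length_group_le (c n r : ℕ) (cl : List (List (ℕ × Bool))) (i : ℕ) :
    (group c n r cl i).length ≤ groupSize c n r :=
  List.length_take_le _ _

theorem group_subset (c n r : ℕ) (cl : List (List (ℕ × Bool))) (i : ℕ) :
    group c n r cl i ⊆ cl := fun _ h => List.mem_of_mem_drop (List.mem_of_mem_take h)

theorem nodup_groupVars (n r : ℕ) (G : List (List (ℕ × Bool))) : (groupVars n r G).Nodup :=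
  List.nodup_range.filter _

theorem length_groupVars_le {n r : ℕ} (hr : 0 < r) {G : List (List (ℕ × Bool))}
    (hG : ∀ C ∈ G, C.length ≤ 3) :
    (groupVars n r G).length ≤ n / r + 1 + 3 * G.length := by
  have h2 : G.flatten.length ≤ 3 * G.length := by
    induction G with
    | nil => simp
    | cons C G ih =>
      have h3 := hG C (by simp)
      have h4 := ih (fun D hD => hG D (by simp [hD]))
      rw [List.flatten_cons, List.length_append, List.length_cons]
      omega
  have h1 : (groupVars n r G).toFinset ⊆
      Finset.range (n / r + 1) ∪ (G.flatten.map Prod.fst).toFinset := by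
    intro x hx
    simp only [groupVars, occurs, List.mem_toFinset, List.mem_filter, List.mem_range,
      Bool.or_eq_true, decide_eq_true_eq, List.any_eq_true, beq_iff_eq] at hx
    rw [Finset.mem_union, Finset.mem_range, Nat.lt_succ_iff, Nat.le_div_iff_mul_le hr]
    rcases hx.2 with h | ⟨C, hC, l, hl, rfl⟩
    · exact .inl h
    · exact .inr (List.mem_toFinset.2 (List.mem_map_of_mem (List.mem_flatten.2 ⟨C, hC, hl⟩)))
  rw [← List.toFinset_card_of_nodup (nodup_groupVars n r G)]
  refine (Finset.card_le_card h1).trans ((Finset.card_union_le _ _).trans ?_)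
  rw [Finset.card_range]
  have h3 := List.toFinset_card_le (G.flatten.map Prod.fst)
  rw [List.length_map] at h3
  omega

/-- The padding variables alone give this bound. They all exist because r ≥ 2 and n > 0 imply ⌊n/r⌋
< n. -/
theorem le_length_groupVars {n r : ℕ} (hn : 0 < n) (hr : 2 ≤ r) (G : List (List (ℕ × Bool))) :
    n / r + 1 ≤ (groupVars n r G).length := by
  have h1 : n / r < n := Nat.div_lt_self hn hr
  rw [← List.toFinset_card_of_nodup (nodup_groupVars n r G), ← Finset.card_range (n / r + 1)]
  refine Finset.card_le_card fun x hx => ?_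
  rw [Finset.mem_range, Nat.lt_succ_iff, Nat.le_div_iff_mul_le (by omega)] at hx
  have h2 := (Nat.le_div_iff_mul_le (by omega : 0 < r)).2 hx
  simp only [groupVars, List.mem_toFinset, List.mem_filter, List.mem_range, Bool.or_eq_true,
    decide_eq_true_eq]
  exact ⟨by omega, .inl hx⟩

/-- Padding contributes the 1, and c(⌊n/r⌋ + 1) clauses with three literals each contribute the 3c.
-/
theorem length_groupVars_group_le (c : ℕ) {n r : ℕ} (hr : 0 < r) {cl : List (List (ℕ × Bool))}
    (hcl : ∀ C ∈ cl, C.length ≤ 3) (i : ℕ) :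
    (groupVars n r (group c n r cl i)).length ≤ (3 * c + 1) * (n / r + 1) := by
  have h1 := length_groupVars_le (n := n) hr fun C hC => hcl C (group_subset c n r cl i hC)
  have h2 := length_group_le c n r cl i
  rw [groupSize_eq c hr] at h2
  nlinarith

end Reduction

/-! ### Programs for the components of the reduction. -/

namespace PolyTime

open Reduction

variable {ι α : Type} {B : ι → ℕ} {x y : ι → Data}

variable {n r i j : ι → ℕ} {G cl : ι → List (List (ℕ × Bool))} {a : ι → List (ℕ × Bool)}

/-- The output is exponential in |V|, so 2^|V| itself has to be bounded polynomially in `B`; this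
also covers the shorter suffixes built on the way. -/
theorem assignments {V : ι → List ℕ} (hx : PolyTime B x x)
    (hV : PolyTime B x fun i => .ofList .ofNat (V i)) (hB : PolyBdd B fun i => 2 ^ (V i).length) :
    PolyTime B x fun i => .ofList (.ofList encodeLit) (assignments (V i)) := by
  refine foldr (F := fun i s => .ofList (.ofList encodeLit) (Reduction.assignments s)) hx hV
    ((hB.mul ((hV.polyBdd_length.mul (hV.2.add (.const 5))).add (.const 2))).add (.const 1))
    (fun i s hs => ?_) (const (.cons .nil .nil)) fun harg => ?_
  · refine (Data.size_ofList_le _ (M := (V i).length * ((Data.ofList .ofNat (V i)).size + 5) + 1)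
      fun α hα => ?_).trans ?_
    · have h1 := map_fst_of_mem_assignments hα
      refine (Data.size_ofList_le _ (M := (Data.ofList .ofNat (V i)).size + 4) fun l hl => ?_).trans
        ?_
      · have h2 : l.1 ∈ V i := hs.subset (h1 ▸ List.mem_map_of_mem hl)
        have h3 := Data.size_le_size_ofList .ofNat h2
        rcases l with ⟨y, _ | _⟩ <;> simp only [encodeLit, Data.ofBool, Data.size] at h3 ⊢ <;> omega
      · have h2 : α.length = s.length := by rw [← h1, List.length_map]
        have h3 := hs.length_le
        rw [h2]
        gcongr
    · rw [length_assignments]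
      gcongr
      · norm_num
      · exact hs.length_le
  · refine (harg.append (harg.map (f := fun p α => (p.1.2.1, true) :: α) harg.snd.fst
      fun x' h ha up => ?_) (harg.map (f := fun p α => (p.1.2.1, false) :: α) harg.snd.fst
      fun x' h ha up => ?_)).congr fun p => rfl
    · exact ((const (.ofBool true)).cons (up _ harg.fst)).cons ha
    · exact ((const (.ofBool false)).cons (up _ harg.fst)).cons ha

theorem occurs (hx : PolyTime B x x) (hi : PolyTime B x fun p => .ofNat (i p))
    (hG : PolyTime B x fun p => .ofList (.ofList encodeLit) (G p)) :
    PolyTime B x fun p => .ofBool (occurs (i p) (G p)) := by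
  refine hx.any (f := fun p C => C.any fun l => l.1 == i p) hG fun x₁ h₁ hC up₁ => ?_
  refine h₁.any (f := fun p l => l.1 == i p.1.1) hC fun x₂ h₂ hl up₂ => ?_
  exact h₂.beq_nat hl.snd (up₂ _ (up₁ _ hi))

theorem satisfies (hx : PolyTime B x x) (ha : PolyTime B x fun p => .ofList encodeLit (a p))
    (hG : PolyTime B x fun p => .ofList (.ofList encodeLit) (G p)) :
    PolyTime B x fun p => .ofBool (satisfies (a p) (G p)) := by
  refine hx.all (f := fun p C => C.any fun l => (a p).any fun m => m.1 == l.1 && m.2 == l.2) hG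
    fun x₁ h₁ hC up₁ => ?_
  refine h₁.any (f := fun p l => (a p.1.1).any fun m => m.1 == l.1 && m.2 == l.2) hC
    fun x₂ h₂ hl up₂ => ?_
  refine h₂.any (e := encodeLit) (f := fun p m => m.1 == p.1.2.1 && m.2 == p.1.2.2)
    (up₂ _ (up₁ _ ha)) fun x₃ h₃ hm up₃ => ?_
  exact (h₃.beq_nat hm.snd (up₃ _ hl.snd)).and (hm.fst.beq_bool (up₃ _ hl.fst))

theorem groupVars (hx : PolyTime B x x) (hn : PolyTime B x fun p => .ofNat (n p))
    (hr : PolyTime B x fun p => .ofNat (r p))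
    (hG : PolyTime B x fun p => .ofList (.ofList encodeLit) (G p)) :
    PolyTime B x fun p => .ofList .ofNat (groupVars (n p) (r p) (G p)) := by
  refine hx.filter (f := fun p x => decide (x * r p ≤ n p) || Reduction.occurs x (G p))
    (hx.range hn) fun x₁ h ha up => ?_
  exact (h.decide_le (h.ofNat_mul ha (up _ hr)) (up _ hn)).or (h.occurs ha (up _ hG))

theorem groupSize (c : ℕ) (hx : PolyTime B x x) (hn : PolyTime B x fun p => .ofNat (n p))
    (hr : PolyTime B x fun p => .ofNat (r p)) :
    PolyTime B x fun p => .ofNat (groupSize c (n p) (r p)) := by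
  refine hx.ofNat_mul (const (.ofNat c)) (hx.length (e := .ofNat) ?_)
  refine hx.filter (f := fun p q => decide (q * r p ≤ n p)) (hx.range hn.succ)
    fun x₁ h ha up => ?_
  exact h.decide_le (h.ofNat_mul ha (up _ hr)) (up _ hn)

theorem group (c : ℕ) (hx : PolyTime B x x) (hn : PolyTime B x fun p => .ofNat (n p))
    (hr : PolyTime B x fun p => .ofNat (r p))
    (hcl : PolyTime B x fun p => .ofList (.ofList encodeLit) (cl p))
    (hi : PolyTime B x fun p => .ofNat (i p)) :
    PolyTime B x fun p => .ofList (.ofList encodeLit) (group c (n p) (r p) (cl p) (i p)) :=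
  hx.take (hx.groupSize c hn hr) (hx.drop (hx.ofNat_mul (hx.groupSize c hn hr) hi) hcl)

theorem varElt {v : ι → ℕ} {s : ι → Bool} (hx : PolyTime B x x)
    (hr : PolyTime B x fun p => .ofNat (r p)) (hv : PolyTime B x fun p => .ofNat (v p))
    (hi : PolyTime B x fun p => .ofNat (i p)) (hj : PolyTime B x fun p => .ofNat (j p))
    (hs : PolyTime B x fun p => .ofBool (s p)) :
    PolyTime B x fun p => .ofNat (varElt (r p) (v p) (i p) (j p) (s p)) := by
  have hs' : PolyTime B x fun p => .ofNat (bif s p then 1 else 0) :=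
    hs.congr fun p => by cases s p <;> rfl
  have h := hx.ofNat_add (hx.ofNat_mul hv hr) hi
  exact hx.ofNat_add (hx.ofNat_mul (hx.ofNat_add (hx.ofNat_mul h hr) hj) (const (.ofNat 2))) hs'

theorem groupElt (hx : PolyTime B x x) (hn : PolyTime B x fun p => .ofNat (n p))
    (hr : PolyTime B x fun p => .ofNat (r p)) (hj : PolyTime B x fun p => .ofNat (j p)) :
    PolyTime B x fun p => .ofNat (groupElt (n p) (r p) (j p)) :=
  hx.ofNat_add (hx.ofNat_mul (hx.ofNat_mul (hx.ofNat_mul hn hr) hr) (const (.ofNat 2))) hj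

theorem flatMap_varElt {v : ι → ℕ} {s : ι → Bool} (hx : PolyTime B x x)
    (hr : PolyTime B x fun p => .ofNat (r p)) (hv : PolyTime B x fun p => .ofNat (v p))
    (hi : PolyTime B x fun p => .ofNat (i p)) (hs : PolyTime B x fun p => .ofBool (s p)) :
    PolyTime B x fun p => .ofList .ofNat ((List.range (r p)).flatMap fun j =>
      [Reduction.varElt (r p) (v p) (i p) j (s p), Reduction.varElt (r p) (v p) j (i p) (!s p)]) := by
  refine hx.flatMap (f := fun p j => [Reduction.varElt (r p) (v p) (i p) j (s p),
    Reduction.varElt (r p) (v p) j (i p) (!s p)]) (hx.range hr) fun x₂ h₂ hj up => ?_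
  have h1 := h₂.varElt (up _ hr) (up _ hv) (up _ hi) hj (up _ hs)
  have h2 := h₂.varElt (up _ hr) (up _ hv) hj (up _ hi) (up _ hs).not
  exact h1.cons (h2.cons nil)

theorem assignmentSet (hx : PolyTime B x x) (hn : PolyTime B x fun p => .ofNat (n p))
    (hr : PolyTime B x fun p => .ofNat (r p))
    (hG : PolyTime B x fun p => .ofList (.ofList encodeLit) (G p))
    (hi : PolyTime B x fun p => .ofNat (i p)) (ha : PolyTime B x fun p => .ofList encodeLit (a p)) :
    PolyTime B x fun p => .ofList .ofNat (assignmentSet (n p) (r p) (G p) (i p) (a p)) := by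
  have h1 := hx.flatMap (e' := .ofNat) (f := fun p m => (List.range (r p)).flatMap fun j =>
    [Reduction.varElt (r p) m.1 (i p) j m.2, Reduction.varElt (r p) m.1 j (i p) (!m.2)]) ha
    fun x₁ h₁ hm up => by
      have hv : PolyTime _ x₁ fun p => .ofNat p.1.2.1 := hm.snd
      have hs : PolyTime _ x₁ fun p => .ofBool p.1.2.2 := hm.fst
      exact h₁.flatMap_varElt (up _ hr) hv (up _ hi) hs
  have h2 : PolyTime B x fun p =>
      .ofList .ofNat ((List.range (r p)).map fun j => Reduction.groupElt (n p) (r p) j) :=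
    hx.map (f := fun p j => Reduction.groupElt (n p) (r p) j) (hx.range hr)
      fun x₁ h₁ hj up => h₁.groupElt (up _ hn) (up _ hr) hj
  have h3 : PolyTime B x fun p => .ofList .ofNat [Reduction.groupElt (n p) (r p) (i p)] :=
    (hx.groupElt hn hr hi).cons nil
  refine hx.append h1 (((hx.satisfies ha hG).cond h3 h2).congr fun p => ?_)
  cases Reduction.satisfies (a p) (G p) <;> rfl

theorem groupSets (c : ℕ) (hx : PolyTime B x x) (hn : PolyTime B x fun p => .ofNat (n p))
    (hr : PolyTime B x fun p => .ofNat (r p))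
    (hcl : PolyTime B x fun p => .ofList (.ofList encodeLit) (cl p))
    (hi : PolyTime B x fun p => .ofNat (i p))
    (hB : PolyBdd B fun p =>
      2 ^ (Reduction.groupVars (n p) (r p) (Reduction.group c (n p) (r p) (cl p) (i p))).length) :
    PolyTime B x fun p =>
      .ofList (.ofList .ofNat) (groupSets c (n p) (r p) (cl p) (i p)) := by
  have hG := hx.group c hn hr hcl hi
  exact hx.map (f := fun p α => Reduction.assignmentSet (n p) (r p)
    (Reduction.group c (n p) (r p) (cl p) (i p)) (i p) α) (hx.assignments (hx.groupVars hn hr hG) hB)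
    fun x₁ h ha up => h.assignmentSet (up _ hn) (up _ hr) (up _ hG) (up _ hi) ha

theorem packingSets (c : ℕ) (hx : PolyTime B x x) (hn : PolyTime B x fun p => .ofNat (n p))
    (hr : PolyTime B x fun p => .ofNat (r p))
    (hcl : PolyTime B x fun p => .ofList (.ofList encodeLit) (cl p))
    (hr0 : ∀ p, 0 < r p) (hcl3 : ∀ p, ∀ C ∈ cl p, C.length ≤ 3)
    (hB : PolyBdd B fun p => 2 ^ (n p / r p)) :
    PolyTime B x fun p => .ofList (.ofList .ofNat) (packingSets c (n p) (r p) (cl p)) := by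
  refine hx.flatMap (f := fun p i => Reduction.groupSets c (n p) (r p) (cl p) i) (hx.range hr)
    fun x₁ h hi up => h.groupSets c (up _ hn) (up _ hr) (up _ hcl) hi ?_
  -- A group has at most (3c + 1)(⌊n/r⌋ + 1) variables, so its number of assignments is at most
  -- (2·2^⌊n/r⌋)^(3c+1).
  refine (((hB.mul (.const 2)).pow (3 * c + 1)).comp
    fun p : {p : ι × ℕ // p.2 ∈ List.range (r p.1)} => p.1.1).mono fun p => ?_
  refine (Nat.pow_le_pow_right (by norm_num)
    (length_groupVars_group_le c (hr0 p.1.1) (hcl3 p.1.1) p.1.2)).trans ?_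
  have h2 : 2 ^ (n p.1.1 / r p.1.1 + 1) = 2 ^ (n p.1.1 / r p.1.1) * 2 := pow_succ _ _
  rw [mul_comm, pow_mul, h2]

end PolyTime

/-- The reduction works with lists of natural numbers. The inclusion of `Fin U` into ℕ is injective,
so passing to honest subsets of the universe changes neither cardinalities nor disjointness. -/
theorem SetPacking.exists_encodedBy {U r : ℕ} {L : List (List ℕ)}
    (hlt : ∀ s ∈ L, ∀ a ∈ s, a < U) (hnd : ∀ s ∈ L, s.Nodup) (hL : (L.map List.toFinset).Nodup) :
    ∃ I : SetPacking, I.size = U ∧ I.param = r ∧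
      I.EncodedBy (.cons (.ofNat U) (.cons (.ofNat r) (.ofList (.ofList .ofNat) L))) ∧
      I.family.card = L.length ∧ ∀ k, I.HasPacking k ↔
        ∃ A : Finset (Finset ℕ), (∀ S ∈ A, ∃ s ∈ L, s.toFinset = S) ∧ A.card = k ∧
          (A : Set (Finset ℕ)).PairwiseDisjoint id := by
  lift L to List (List (Fin U)) using hlt
  have hval : ∀ s : List (Fin U), (s.map Fin.val).toFinset = s.toFinset.map Fin.valEmbedding := by
    intro s
    ext a
    simp
  have hL' : (L.map List.toFinset).Nodup := by
    refine List.Nodup.of_map (Finset.map Fin.valEmbedding) ?_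
    convert hL using 1
    simp only [List.map_map]
    exact List.map_congr_left fun s _ => (hval s).symm
  have hnd' : ∀ s ∈ L, s.Nodup := fun s hs => (hnd _ (List.mem_map_of_mem hs)).of_map _
  refine ⟨⟨U, (L.map List.toFinset).toFinset, r⟩, rfl, rfl, ⟨L, hnd', hL', rfl, ?_⟩, ?_, fun k => ?_⟩
  · congr 2
    rw [Data.ofList_map]
    exact Data.ofList_congr fun s _ => Data.ofList_map _ _ _
  · rw [List.toFinset_card_of_nodup hL', List.length_map, List.length_map]
  · have hdis : ∀ A : Finset (Finset (Fin U)), (A : Set (Finset (Fin U))).PairwiseDisjoint id ↔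
        ((A.map (Finset.mapEmbedding Fin.valEmbedding).toEmbedding : Finset (Finset ℕ)) :
          Set (Finset ℕ)).PairwiseDisjoint id := by
      intro A
      rw [Finset.coe_map, Set.InjOn.pairwiseDisjoint_image
        (Finset.mapEmbedding Fin.valEmbedding).toEmbedding.injective.injOn]
      simp only [Set.PairwiseDisjoint, Set.Pairwise, Function.onFun, Function.comp, id,
        RelEmbedding.coe_toEmbedding, Finset.mapEmbedding_apply, Finset.disjoint_map]
    constructor
    · rintro ⟨A, hA, hk, hd⟩
      refine ⟨A.map (Finset.mapEmbedding Fin.valEmbedding).toEmbedding, fun S hS => ?_, ?_,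
        (hdis A).1 hd⟩
      · obtain ⟨T, hT, rfl⟩ := Finset.mem_map.1 hS
        obtain ⟨s, hs, rfl⟩ := List.mem_map.1 (List.mem_toFinset.1 (hA hT))
        exact ⟨_, List.mem_map_of_mem hs, hval s⟩
      · rw [Finset.card_map, hk]
    · rintro ⟨A, hA, hk, hd⟩
      -- The packing is pulled back by keeping the members of the family whose image lies in `A`.
      have hA' : ((L.map List.toFinset).toFinset.filter fun S => S.map Fin.valEmbedding ∈ A).map
          (Finset.mapEmbedding Fin.valEmbedding).toEmbedding = A := by
        ext S
        simp only [Finset.mem_map, Finset.mem_filter, List.mem_toFinset, List.mem_map]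
        constructor
        · rintro ⟨T, ⟨-, hT⟩, rfl⟩
          exact hT
        · intro hS
          obtain ⟨s, hs, rfl⟩ := hA S hS
          obtain ⟨s, hs', rfl⟩ := List.mem_map.1 hs
          exact ⟨s.toFinset, ⟨⟨s, hs', rfl⟩, hval s ▸ hS⟩, (hval s).symm⟩
      refine ⟨_, Finset.filter_subset _ _, ?_, (hdis _).2 (hA' ▸ hd)⟩
      rw [← hk, ← hA', Finset.card_map]
      simp only [hA']

/-! ### Combinatorics of the sets: distinctness, counting, correctness. -/

namespace Reduction

variable {c n r : ℕ} {cl G : List (List (ℕ × Bool))} {V : List ℕ} {α β : List (ℕ × Bool)}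

/-- `varElt` is a mixed-radix number with digits x, i, j, s; the digits are recovered from the last
one upwards. -/
theorem varElt_inj {x i j x' i' j' : ℕ} {s s' : Bool} (hi : i < r) (hj : j < r) (hi' : i' < r)
    (hj' : j' < r) (h : varElt r x i j s = varElt r x' i' j' s') :
    x = x' ∧ i = i' ∧ j = j' ∧ s = s' := by
  have key : ∀ {r a b a' b' : ℕ}, b < r → b' < r → a * r + b = a' * r + b' → a = a' ∧ b = b' := by
    intro r a b a' b' hb hb' h
    have h1 : a = a' := by
      have h1 := congrArg (· / r) h
      have hr : 0 < r := by omega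
      simpa [Nat.add_div_of_dvd_right, Nat.div_eq_of_lt hb, Nat.div_eq_of_lt hb',
        Nat.mul_div_cancel _ hr] using h1
    subst h1
    exact ⟨rfl, by omega⟩
  have hs : ∀ s : Bool, (bif s then 1 else 0) < 2 := by decide
  obtain ⟨h1, h2⟩ := key (hs s) (hs s') h
  obtain ⟨h3, rfl⟩ := key hj hj' h1
  obtain ⟨rfl, rfl⟩ := key hi hi' h3
  refine ⟨rfl, rfl, rfl, ?_⟩
  cases s <;> cases s' <;> simp_all

theorem varElt_lt {x i j : ℕ} {s : Bool} (hx : x < n) (hi : i < r) (hj : j < r) :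
    varElt r x i j s < n * r * r * 2 := by
  have key : ∀ {m r a b : ℕ}, a < m → b < r → a * r + b < m * r := by
    intro m r a b ha hb
    calc a * r + b < a * r + r := by omega
      _ = (a + 1) * r := by ring
      _ ≤ m * r := Nat.mul_le_mul_right _ ha
  exact key (key (key hx hi) hj) (by cases s <;> decide)

theorem mem_groupVars {x : ℕ} :
    x ∈ groupVars n r G ↔ x < n ∧ (x * r ≤ n ∨ ∃ C ∈ G, ∃ l ∈ C, l.1 = x) := by
  simp [groupVars, occurs]

theorem satisfies_iff : satisfies α G = true ↔ ∀ C ∈ G, ∃ l ∈ C, l ∈ α := by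
  simp only [satisfies, List.all_eq_true, List.any_eq_true, Bool.and_eq_true, beq_iff_eq]
  refine forall₂_congr fun C _ => exists_congr fun l => and_congr_right fun _ => ?_
  constructor
  · rintro ⟨m, hm, h1, h2⟩
    rwa [← Prod.ext h1 h2]
  · exact fun h => ⟨l, h, rfl, rfl⟩

theorem nodup_assignments (V : List ℕ) : (assignments V).Nodup := by
  induction V with
  | nil => simp [assignments]
  | cons x V ih =>
    have hinj : ∀ b : Bool, Function.Injective fun α : List (ℕ × Bool) => (x, b) :: α :=
      fun b α β h => (List.cons.inj h).2
    refine List.nodup_append.2 ⟨ih.map (hinj true), ih.map (hinj false), ?_⟩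
    simp

theorem map_mem_assignments (v : ℕ → Bool) (V : List ℕ) :
    V.map (fun x => (x, v x)) ∈ assignments V := by
  induction V with
  | nil => simp [assignments]
  | cons x V ih => cases h : v x <;> simp [assignments, h, ih]

theorem fst_mem_of_mem_assignments (hα : α ∈ assignments V) {x : ℕ} {s : Bool} (h : (x, s) ∈ α) :
    x ∈ V :=
  map_fst_of_mem_assignments hα ▸ List.mem_map_of_mem h

theorem exists_mem_of_mem_assignments (hα : α ∈ assignments V) {x : ℕ} (h : x ∈ V) :
    ∃ s, (x, s) ∈ α := by
  rw [← map_fst_of_mem_assignments hα] at h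
  obtain ⟨⟨y, s⟩, hy, rfl⟩ := List.mem_map.1 h
  exact ⟨s, hy⟩

theorem eq_of_mem_of_mem (hV : V.Nodup) (hα : α ∈ assignments V) {x : ℕ} {s s' : Bool}
    (h : (x, s) ∈ α) (h' : (x, s') ∈ α) : s = s' := by
  rw [← map_fst_of_mem_assignments hα] at hV
  exact congrArg Prod.snd (List.inj_on_of_nodup_map hV h h' rfl)

/-- Both lists run through the same variables in the same order, and each variable has one sign in
each, so inclusion of literals leaves no freedom. -/
theorem eq_of_subset (hV : V.Nodup) (hα : α ∈ assignments V) (hβ : β ∈ assignments V)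
    (h : α ⊆ β) : α = β := by
  induction V generalizing α β with
  | nil => simp_all [assignments]
  | cons x V ih =>
    rw [List.nodup_cons] at hV
    have hcons : ∀ α ∈ assignments (x :: V), ∃ s, ∃ α' ∈ assignments V, α = (x, s) :: α' := by
      intro α hα
      simp only [assignments, List.mem_append, List.mem_map] at hα
      rcases hα with ⟨α', h, rfl⟩ | ⟨α', h, rfl⟩ <;> exact ⟨_, _, h, rfl⟩
    obtain ⟨s, α', hα', rfl⟩ := hcons α hα
    obtain ⟨s', β', hβ', rfl⟩ := hcons β hβ
    rw [List.cons_subset, List.mem_cons] at h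
    have h1 : s = s' := by
      rcases h.1 with h1 | h1
      · exact (Prod.mk.inj h1).2
      · exact absurd (fst_mem_of_mem_assignments hβ' h1) hV.1
    rw [h1, ih hV.2 hα' hβ' fun m hm => ?_]
    refine (List.mem_cons.1 (h.2 hm)).resolve_left ?_
    rintro rfl
    exact hV.1 (fst_mem_of_mem_assignments hα' hm)

theorem mem_assignmentSet {i e : ℕ} (hi : i < r) : e ∈ assignmentSet n r G i α ↔
    (∃ x s j, (x, s) ∈ α ∧ j < r ∧ (e = varElt r x i j s ∨ e = varElt r x j i (!s))) ∨
      ∃ j < r, (j = i ∨ satisfies α G = false) ∧ e = groupElt n r j := by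
  rw [assignmentSet, List.mem_append]
  refine or_congr ?_ ?_
  · simp only [List.mem_flatMap, List.mem_range, List.mem_cons, List.not_mem_nil, or_false,
      Prod.exists]
    constructor
    · rintro ⟨x, s, h, j, hj, h'⟩
      exact ⟨x, s, j, h, hj, h'⟩
    · rintro ⟨x, s, j, h, hj, h'⟩
      exact ⟨x, s, h, j, hj, h'⟩
  · cases h : satisfies α G
    · simp [eq_comm]
    · simp only [cond_true, List.mem_singleton, reduceCtorEq, or_false]
      constructor
      · rintro rfl
        exact ⟨i, hi, rfl, rfl⟩
      · rintro ⟨j, -, rfl, h⟩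
        exact h

theorem groupElt_mem {i : ℕ} (hi : i < r) : groupElt n r i ∈ assignmentSet n r G i α :=
  (mem_assignmentSet hi).2 (.inr ⟨i, hi, .inl rfl, rfl⟩)

theorem varElt_mem_assignmentSet {x i p q : ℕ} {s : Bool} (hx : x < n)
    (hi : i < r) (hp : p < r) (hq : q < r) :
    varElt r x p q s ∈ assignmentSet n r G i α ↔
      p = i ∧ (x, s) ∈ α ∨ q = i ∧ (x, !s) ∈ α := by
  rw [mem_assignmentSet hi]
  constructor
  · rintro (⟨y, b, j, h, hj, h' | h'⟩ | ⟨j, hj, -, h⟩)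
    · obtain ⟨rfl, rfl, rfl, rfl⟩ := varElt_inj hp hq hi hj h'
      exact .inl ⟨rfl, h⟩
    · obtain ⟨rfl, rfl, rfl, rfl⟩ := varElt_inj hp hq hj hi h'
      exact .inr ⟨rfl, by simpa using h⟩
    · have := varElt_lt (s := s) hx hp hq
      rw [h, groupElt] at this
      omega
  · rintro (⟨rfl, h⟩ | ⟨rfl, h⟩)
    · exact .inl ⟨x, s, q, h, hq, .inl rfl⟩
    · exact .inl ⟨x, _, p, h, hp, .inr (by simp)⟩

theorem groupElt_mem_assignmentSet {i j : ℕ} (hα : ∀ y ∈ α, y.1 < n) (hi : i < r) (hj : j < r) :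
    groupElt n r j ∈ assignmentSet n r G i α ↔ j = i ∨ satisfies α G = false := by
  rw [mem_assignmentSet hi]
  constructor
  · rintro (⟨y, b, k, h, hk, h' | h'⟩ | ⟨k, hk, h, h'⟩)
    · have := varElt_lt (s := b) (hα _ h) hi hk
      rw [← h', groupElt] at this
      omega
    · have := varElt_lt (s := !b) (hα _ h) hk hi
      rw [← h', groupElt] at this
      omega
    · obtain rfl : j = k := by simpa [groupElt] using h'
      exact h
  · exact fun h => .inr ⟨j, hj, h, rfl⟩

theorem lt_universeSize {i e : ℕ} (hα : ∀ y ∈ α, y.1 < n) (hi : i < r)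
    (he : e ∈ assignmentSet n r G i α) : e < universeSize n r := by
  rw [universeSize]
  rcases (mem_assignmentSet hi).1 he with ⟨x, s, j, h, hj, rfl | rfl⟩ | ⟨j, hj, -, rfl⟩
  · have : varElt r x i j s < _ := varElt_lt (hα _ h) hi hj
    omega
  · have : varElt r x j i (!s) < _ := varElt_lt (hα _ h) hj hi
    omega
  · rw [groupElt]
    omega

theorem nodup_assignmentSet {i : ℕ} (hα : ∀ y ∈ α, y.1 < n) (hα' : (α.map Prod.fst).Nodup)
    (hi : i < r) : (assignmentSet n r G i α).Nodup := by
  refine List.nodup_append.2 ⟨List.nodup_flatMap.2 ⟨fun m hm => List.nodup_flatMap.2 ⟨?_, ?_⟩, ?_⟩,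
    ?_, ?_⟩
  -- The two elements listed for `j` differ in their sign, even when j = i.
  · intro j hj
    simp only [List.nodup_cons, List.mem_singleton, List.not_mem_nil, not_false_eq_true,
      List.nodup_nil, and_true]
    intro h
    have hj := List.mem_range.1 hj
    have := (varElt_inj hi hj hj hi h).2.2.2
    simp at this
  · refine List.nodup_range.imp_of_mem ?_
    intro j k hj hk hjk
    have hj := List.mem_range.1 hj
    have hk := List.mem_range.1 hk
    simp only [Function.onFun, List.disjoint_left, List.mem_cons, List.not_mem_nil, or_false]
    rintro e (rfl | rfl) (h | h)
    · exact hjk (varElt_inj hi hj hi hk h).2.2.1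
    · simpa using (varElt_inj hi hj hk hi h).2.2.2
    · simpa using (varElt_inj hj hi hi hk h).2.2.2
    · exact hjk (varElt_inj hj hi hk hi h).2.1
  · refine (List.pairwise_map.1 hα').imp ?_
    intro m m' hmm
    simp only [Function.onFun, List.disjoint_left, List.mem_flatMap, List.mem_range, List.mem_cons,
      List.not_mem_nil, or_false]
    rintro e ⟨j, hj, rfl | rfl⟩ ⟨k, hk, h | h⟩
    · exact hmm (varElt_inj hi hj hi hk h).1
    · exact hmm (varElt_inj hi hj hk hi h).1
    · exact hmm (varElt_inj hj hi hi hk h).1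
    · exact hmm (varElt_inj hj hi hk hi h).1
  · cases satisfies α G
    · exact List.nodup_range.map fun j k h => by simpa [groupElt] using h
    · exact List.nodup_singleton _
  · rintro e he f hf rfl
    have h1 : n * r * r * 2 ≤ e := by
      revert hf
      cases satisfies α G
      · simp only [cond_false, List.mem_map]
        rintro ⟨j, -, rfl⟩
        exact Nat.le_add_right _ _
      · simp only [cond_true, List.mem_singleton]
        rintro rfl
        exact Nat.le_add_right _ _
    simp only [List.mem_flatMap, List.mem_range, List.mem_cons, List.not_mem_nil, or_false] at he
    obtain ⟨m, hm, j, hj, rfl | rfl⟩ := he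
    · exact h1.not_gt (varElt_lt (hα _ hm) hi hj)
    · exact h1.not_gt (varElt_lt (hα _ hm) hj hi)

theorem lt_of_mem_of_mem_assignments (hα : α ∈ assignments (groupVars n r G)) :
    ∀ y ∈ α, y.1 < n := fun _ hy =>
  (mem_groupVars.1 (fst_mem_of_mem_assignments hα hy)).1

/-- Sets of different groups are different. -/
theorem group_eq_of_toFinset_eq {G' : List (List (ℕ × Bool))} {i j : ℕ} (hn : 0 < n) (hi : i < r)
    (hj : j < r) (hα : α ∈ assignments (groupVars n r G))
    (h : (assignmentSet n r G i α).toFinset = (assignmentSet n r G' j β).toFinset) : i = j := by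
  -- By the padding, variable 0 belongs to the group. Its element for the pair (i, i) can lie only
  -- in sets of group i.
  obtain ⟨s, hs⟩ := exists_mem_of_mem_assignments hα (mem_groupVars.2 ⟨hn, .inl (by simp)⟩)
  have h1 : varElt r 0 i i s ∈ (assignmentSet n r G i α).toFinset := by
    rw [List.mem_toFinset, varElt_mem_assignmentSet hn hi hi hi]
    exact .inl ⟨rfl, hs⟩
  rw [h, List.mem_toFinset,
    varElt_mem_assignmentSet hn hj hi hi] at h1
  rcases h1 with h1 | h1 <;> exact h1.1

/-- Sets for different assignments to the variables of the same group are different. -/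
theorem assignment_eq_of_toFinset_eq {i : ℕ} (hr : 2 ≤ r) (hi : i < r)
    (hα : α ∈ assignments (groupVars n r G)) (hβ : β ∈ assignments (groupVars n r G))
    (h : (assignmentSet n r G i α).toFinset = (assignmentSet n r G i β).toFinset) : α = β := by
  -- A second index is needed to read off the sign of a variable: the element for (i, i) lies in the
  -- set for either sign. This is a place where r ≥ 2 is essential.
  obtain ⟨j, hj, hij⟩ : ∃ j < r, j ≠ i := by
    rcases Nat.eq_zero_or_pos i with rfl | h
    · exact ⟨1, by omega, by omega⟩
    · exact ⟨0, by omega, by omega⟩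
  refine eq_of_subset (nodup_groupVars n r G) hα hβ fun ⟨x, s⟩ hx => ?_
  have hxn := lt_of_mem_of_mem_assignments hα _ hx
  have h1 : varElt r x i j s ∈ (assignmentSet n r G i α).toFinset := by
    rw [List.mem_toFinset, varElt_mem_assignmentSet hxn hi hi hj]
    exact .inl ⟨rfl, hx⟩
  rw [h, List.mem_toFinset,
    varElt_mem_assignmentSet hxn hi hi hj] at h1
  rcases h1 with h1 | h1
  · exact h1.2
  · exact absurd h1.1 hij

theorem mem_packingSets {s : List ℕ} : s ∈ packingSets c n r cl ↔
    ∃ i < r, ∃ α ∈ assignments (groupVars n r (group c n r cl i)),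
      s = assignmentSet n r (group c n r cl i) i α := by
  simp [packingSets, groupSets, eq_comm]

theorem nodup_map_toFinset_packingSets (hn : 0 < n) (hr : 2 ≤ r) :
    ((packingSets c n r cl).map List.toFinset).Nodup := by
  rw [packingSets, List.map_flatMap]
  refine List.nodup_flatMap.2 ⟨fun i hi => ?_, List.nodup_range.imp_of_mem ?_⟩
  · rw [groupSets, List.map_map]
    refine (nodup_assignments _).map_on fun α hα β hβ h => ?_
    exact assignment_eq_of_toFinset_eq hr (List.mem_range.1 hi) hα hβ h
  · intro i j hi hj hij
    simp only [Function.onFun, List.disjoint_left, groupSets, List.map_map, List.mem_map]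
    rintro S ⟨α, hα, rfl⟩ ⟨β, hβ, h⟩
    exact hij (group_eq_of_toFinset_eq hn (List.mem_range.1 hi) (List.mem_range.1 hj) hα h.symm)

/-- The groups have room for r·c(⌊n/r⌋ + 1) ≥ cn clauses, and the clause at position t falls into
the group with index t divided by the group size. -/
theorem exists_mem_group (hr : 0 < r) (hcl : cl.length ≤ c * n) {C : List (ℕ × Bool)}
    (hC : C ∈ cl) : ∃ i < r, C ∈ group c n r cl i := by
  obtain ⟨t, ht, rfl⟩ := List.getElem_of_mem hC
  have hk : c * n ≤ groupSize c n r * r := by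
    rw [groupSize_eq c hr, mul_assoc]
    refine Nat.mul_le_mul_left _ ?_
    have := Nat.lt_div_mul_add (a := n) hr
    rw [Nat.succ_mul]
    omega
  have hk0 : 0 < groupSize c n r := by
    by_contra h
    have h : groupSize c n r = 0 := by omega
    rw [h] at hk
    omega
  refine ⟨t / groupSize c n r, ?_, ?_⟩
  · rw [Nat.div_lt_iff_lt_mul hk0]
    calc t < groupSize c n r * r := by omega
      _ = _ := mul_comm _ _
  · rw [group, List.mem_take_iff_getElem]
    have h1 := Nat.div_add_mod t (groupSize c n r)
    have h2 := Nat.mod_lt t hk0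
    refine ⟨t % groupSize c n r, ?_, ?_⟩
    · rw [List.length_drop]
      omega
    · rw [List.getElem_drop]
      congr 1

theorem length_packingSets (c n r : ℕ) (cl : List (List (ℕ × Bool))) :
    (packingSets c n r cl).length =
      ∑ i ∈ Finset.range r, 2 ^ (groupVars n r (group c n r cl i)).length := by
  simp only [packingSets, List.length_flatMap, groupSets, List.length_map, length_assignments]
  rfl

theorem le_length_packingSets (hn : 0 < n) (hr : 2 ≤ r) :
    r * 2 ^ (n / r + 1) ≤ (packingSets c n r cl).length := by
  rw [length_packingSets]
  simpa using Finset.card_nsmul_le_sum (Finset.range r) _ (2 ^ (n / r + 1)) fun i _ =>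
    Nat.pow_le_pow_right (by norm_num : 0 < 2) (le_length_groupVars hn hr (group c n r cl i))

theorem length_packingSets_le (hr : 0 < r) (hcl : ∀ C ∈ cl, C.length ≤ 3) :
    (packingSets c n r cl).length ≤ r * 2 ^ ((3 * c + 1) * (n / r + 1)) := by
  rw [length_packingSets]
  simpa using Finset.sum_le_card_nsmul (Finset.range r) _ (2 ^ ((3 * c + 1) * (n / r + 1)))
    fun i _ => Nat.pow_le_pow_right (by norm_num : 0 < 2) (length_groupVars_group_le c hr hcl i)

/-- Each group takes the restriction of `v` to its variables. A common `varElt` of two different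
groups would give a variable both values under `v`, and a common `groupElt` is impossible since all
restrictions satisfy their groups. -/
theorem exists_packing_of_satisfiable (hn : 0 < n) (hcl : ∀ C ∈ cl, ∀ l ∈ C, l.1 < n)
    {v : ℕ → Bool} (hv : ∀ C ∈ cl, ∃ l ∈ C, v l.1 = l.2) :
    ∃ A : Finset (Finset ℕ), (∀ S ∈ A, ∃ s ∈ packingSets c n r cl, s.toFinset = S) ∧ A.card = r ∧
      (A : Set (Finset ℕ)).PairwiseDisjoint id := by
  set a : ℕ → List (ℕ × Bool) := fun i =>
    (groupVars n r (group c n r cl i)).map fun x => (x, v x) with ha_def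
  have ha : ∀ i, a i ∈ assignments (groupVars n r (group c n r cl i)) :=
    fun i => map_mem_assignments v _
  have hav : ∀ i x s, (x, s) ∈ a i → v x = s := by
    intro i x s h
    obtain ⟨y, -, h⟩ := List.mem_map.1 h
    obtain ⟨rfl, rfl⟩ := Prod.mk.inj h
    rfl
  have hsat : ∀ i, satisfies (a i) (group c n r cl i) = true := by
    intro i
    refine satisfies_iff.2 fun C hC => ?_
    have hC' := group_subset c n r cl i hC
    obtain ⟨l, hl, h⟩ := hv C hC'
    exact ⟨l, hl, List.mem_map.2 ⟨l.1, mem_groupVars.2 ⟨hcl C hC' l hl, .inr ⟨C, hC, l, hl, rfl⟩⟩,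
      Prod.ext rfl h⟩⟩
  refine ⟨(Finset.range r).image fun i =>
    (assignmentSet n r (group c n r cl i) i (a i)).toFinset, fun S hS => ?_, ?_, ?_⟩
  · obtain ⟨i, hi, rfl⟩ := Finset.mem_image.1 hS
    exact ⟨_, mem_packingSets.2 ⟨i, Finset.mem_range.1 hi, a i, ha i, rfl⟩, rfl⟩
  · rw [Finset.card_image_of_injOn, Finset.card_range]
    intro i hi j hj h
    exact group_eq_of_toFinset_eq hn (by simpa using hi) (by simpa using hj) (ha i) h
  · intro S hS T hT hST
    simp only [Finset.coe_image, Set.mem_image, Finset.mem_coe, Finset.mem_range] at hS hT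
    obtain ⟨i, hi, rfl⟩ := hS
    obtain ⟨j, hj, rfl⟩ := hT
    have hij : i ≠ j := by
      rintro rfl
      exact hST rfl
    simp only [Function.onFun, id, Finset.disjoint_left, List.mem_toFinset]
    intro e he he'
    have hα := lt_of_mem_of_mem_assignments (ha i)
    have hβ := lt_of_mem_of_mem_assignments (ha j)
    rcases (mem_assignmentSet hi).1 he with ⟨x, s, k, h, hk, rfl | rfl⟩ | ⟨k, hk, h, rfl⟩
    · rw [varElt_mem_assignmentSet (hα _ h) hj hi hk] at he'
      rcases he' with ⟨h', -⟩ | ⟨-, h'⟩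
      · exact hij h'
      · have h1 := hav _ _ _ h
        have h2 := hav _ _ _ h'
        rw [h1] at h2
        simp at h2
    · rw [varElt_mem_assignmentSet (hα _ h) hj hk hi] at he'
      rcases he' with ⟨-, h'⟩ | ⟨h', -⟩
      · have h1 := hav _ _ _ h
        have h2 := hav _ _ _ h'
        rw [h1] at h2
        simp at h2
      · exact hij h'
    · rw [groupElt_mem_assignmentSet hβ hj hk, hsat] at he'
      rw [hsat] at h
      simp only [reduceCtorEq, or_false] at h he'
      exact hij (h.symm.trans he')

/-- The packing selects one satisfying assignment from every group. Disjointness makes the selected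
assignments consistent, so they glue. -/
theorem satisfiable_of_exists_packing (hr : 2 ≤ r) (hlen : cl.length ≤ c * n)
    {A : Finset (Finset ℕ)} (hA : ∀ S ∈ A, ∃ s ∈ packingSets c n r cl, s.toFinset = S)
    (hAr : A.card = r) (hd : (A : Set (Finset ℕ)).PairwiseDisjoint id) :
    ∃ v : ℕ → Bool, ∀ C ∈ cl, ∃ l ∈ C, v l.1 = l.2 := by
  have hA' : ∀ S ∈ A, ∃ i < r, ∃ α ∈ assignments (groupVars n r (group c n r cl i)),
      satisfies α (group c n r cl i) = true ∧
        (assignmentSet n r (group c n r cl i) i α).toFinset = S := by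
    intro S hS
    obtain ⟨s, hs, rfl⟩ := hA S hS
    obtain ⟨i, hi, α, hα, rfl⟩ := mem_packingSets.1 hs
    refine ⟨i, hi, α, hα, ?_, rfl⟩
    by_contra hsat
    -- As r ≥ 2, the packing has another member, and a set of a violating assignment meets it in the
    -- group element of that member.
    obtain ⟨T, hT, hTS⟩ := Finset.exists_mem_ne (by omega : 1 < A.card)
      (assignmentSet n r (group c n r cl i) i α).toFinset
    obtain ⟨t, ht, rfl⟩ := hA T hT
    obtain ⟨j, hj, β, hβ, rfl⟩ := mem_packingSets.1 ht
    refine Finset.disjoint_left.1 (hd hT hS hTS) (List.mem_toFinset.2 (groupElt_mem hj))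
      (List.mem_toFinset.2 ((groupElt_mem_assignmentSet (lt_of_mem_of_mem_assignments hα) hi hj).2
        (.inr (by simpa using hsat))))
  choose! g hg a ha hsat hS using hA'
  have hsub : ∀ S ∈ A, ∀ e ∈ assignmentSet n r (group c n r cl (g S)) (g S) (a S), e ∈ S := by
    intro S h e he
    rwa [← List.mem_toFinset, hS S h] at he
  have hmem : ∀ S ∈ A, groupElt n r (g S) ∈ S := fun S h => hsub S h _ (groupElt_mem (hg S h))
  -- Two members from one group would share its group element; by counting, every group is then
  -- used.
  have hinj : Set.InjOn g A := by
    intro S h T h' hST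
    by_contra hne
    refine Finset.disjoint_left.1 (hd h h' hne) (hmem S h) ?_
    rw [hST]
    exact hmem T h'
  have hsurj : ∀ i < r, ∃ S ∈ A, g S = i := by
    intro i hi
    have : A.image g = Finset.range r := by
      refine Finset.eq_of_subset_of_card_le (fun j hj => ?_) ?_
      · obtain ⟨S, h, rfl⟩ := Finset.mem_image.1 hj
        exact Finset.mem_range.2 (hg S h)
      · rw [Finset.card_image_of_injOn hinj, hAr, Finset.card_range]
    exact Finset.mem_image.1 (this ▸ Finset.mem_range.2 hi)
  classical
  -- Positive literals of selected assignments hold by definition. A negative one could fail only if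
  -- another selected assignment made the variable true, and then the two sets would share a
  -- `varElt`.
  refine ⟨fun x => decide (∃ S ∈ A, (x, true) ∈ a S), fun C hC => ?_⟩
  obtain ⟨i, hi, hCi⟩ := exists_mem_group (by omega : 0 < r) hlen hC
  obtain ⟨S, h, rfl⟩ := hsurj i hi
  obtain ⟨⟨x, s⟩, hl, hlS⟩ := satisfies_iff.1 (hsat S h) C hCi
  refine ⟨(x, s), hl, ?_⟩
  cases s
  · simp only [decide_eq_false_iff_not, not_exists, not_and]
    intro T h' hT
    have hST : S ≠ T := by
      rintro rfl
      have := eq_of_mem_of_mem (nodup_groupVars _ _ _) (ha S h) hlS hT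
      simp at this
    have hxn := lt_of_mem_of_mem_assignments (ha S h) _ hlS
    refine Finset.disjoint_left.1 (hd h h' hST) (?_ : varElt r x (g S) (g T) false ∈ S) ?_
    · exact hsub S h _ ((varElt_mem_assignmentSet hxn (hg S h) (hg S h) (hg T h')).2
        (.inl ⟨rfl, hlS⟩))
    · exact hsub T h' _ ((varElt_mem_assignmentSet hxn (hg T h') (hg S h) (hg T h')).2
        (.inr ⟨rfl, hT⟩))
  · simp only [decide_eq_true_eq]
    exact ⟨S, h, hlS⟩

/-! ### The program of the reduction. -/

/-- The instance for the clauses `cl`, as a tree. -/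
def output (c n r : ℕ) (cl : List (List (ℕ × Bool))) : Data :=
  .cons (.ofNat (universeSize n r)) (.cons (.ofNat r)
    (.ofList (.ofList .ofNat) (packingSets c n r cl)))

theorem size_encodeLit_le {n : ℕ} {l : ℕ × Bool} (hl : l.1 < n) :
    (encodeLit l).size ≤ 2 * n + 4 := by
  rcases l with ⟨x, _ | _⟩ <;>
    simp only [encodeLit, Data.ofBool, Data.size, Data.size_ofNat] at hl ⊢ <;> omega

theorem size_clauses_le {n : ℕ} {cl : List (List (ℕ × Bool))}
    (h3 : ∀ C ∈ cl, C.length ≤ 3) (hlt : ∀ C ∈ cl, ∀ l ∈ C, l.1 < n) :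
    (Data.ofList (.ofList encodeLit) cl).size ≤ cl.length * (3 * (2 * n + 5) + 2) + 1 := by
  refine Data.size_ofList_le _ fun C hC => ?_
  refine (Data.size_ofList_le _ fun l hl => size_encodeLit_le (hlt C hC l hl)).trans ?_
  gcongr
  exact h3 C hC

/-- The reduction is computed, once the number `r` of groups is known, in time polynomial in
`2 ^ ⌊n / r⌋ * n * r`. -/
theorem exists_prog (c : ℕ) : ∃ (P : Prog) (k : ℕ), ∀ (n r : ℕ) (cl : List (List (ℕ × Bool))),
    1 ≤ n → 2 ≤ r → cl.length ≤ c * n → (∀ C ∈ cl, C.length ≤ 3) →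
    (∀ C ∈ cl, ∀ l ∈ C, l.1 < n) →
    P.OutputsIn (.cons (.cons (.ofNat n) (.ofList (.ofList encodeLit) cl)) (.ofNat r))
      (output c n r cl) ((2 ^ (n / r) * (n * r)) ^ k) := by
  -- All admissible inputs form one index type, so that a single program and a single exponent serve
  -- them all.
  let ι := {p : ℕ × ℕ × List (List (ℕ × Bool)) // 1 ≤ p.1 ∧ 2 ≤ p.2.1 ∧ p.2.2.length ≤ c * p.1 ∧
    (∀ C ∈ p.2.2, C.length ≤ 3) ∧ ∀ C ∈ p.2.2, ∀ l ∈ C, l.1 < p.1}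
  let B : ι → ℕ := fun p => 2 ^ (p.1.1 / p.1.2.1) * (p.1.1 * p.1.2.1)
  let x : ι → Data := fun p =>
    .cons (.cons (.ofNat p.1.1) (.ofList (.ofList encodeLit) p.1.2.2)) (.ofNat p.1.2.1)
  have hB1 : PolyBdd B fun p => 2 ^ (p.1.1 / p.1.2.1) := PolyBdd.self.mono fun p =>
    Nat.le_mul_of_pos_right _ (Nat.mul_pos p.2.1 (by have := p.2.2.1; omega))
  have hB2 : PolyBdd B fun p => p.1.1 * p.1.2.1 := PolyBdd.self.mono fun p =>
    Nat.le_mul_of_pos_left _ (by positivity)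
  have hn : PolyBdd B fun p => p.1.1 := hB2.mono fun p =>
    Nat.le_mul_of_pos_right _ (by have := p.2.2.1; omega)
  have hr : PolyBdd B fun p => p.1.2.1 := hB2.mono fun p => Nat.le_mul_of_pos_left _ p.2.1
  have hx : PolyTime B x x := by
    refine PolyTime.arg ((((((PolyBdd.const c).mul hn).mul (((PolyBdd.const 3).mul
      (((PolyBdd.const 2).mul hn).add (.const 5))).add (.const 2))).add
      ((PolyBdd.const 2).mul hn)).add ((PolyBdd.const 2).mul hr)).add (.const 5) |>.mono ?_)
    rintro ⟨⟨n, r, cl⟩, hn, hr, hlen, h3, hlt⟩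
    have h1 := size_clauses_le h3 hlt
    have h2 : cl.length * (3 * (2 * n + 5) + 2) ≤ c * n * (3 * (2 * n + 5) + 2) :=
      Nat.mul_le_mul_right _ hlen
    simp only [x, Data.size, Data.size_ofNat] at h1 ⊢
    omega
  have hn' : PolyTime B x fun p => .ofNat p.1.1 := hx.fst.fst
  have hr' : PolyTime B x fun p => .ofNat p.1.2.1 := hx.snd
  have hcl' : PolyTime B x fun p => .ofList (.ofList encodeLit) p.1.2.2 := hx.fst.snd
  have hsets := hx.packingSets c hn' hr' hcl' (fun p => by have := p.2.2.1; omega)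
    (fun p => p.2.2.2.2.1) hB1
  have hU : PolyTime B x fun p => .ofNat (universeSize p.1.1 p.1.2.1) :=
    hx.ofNat_add (hx.ofNat_mul (hx.ofNat_mul (hx.ofNat_mul hn' hr') hr') (.const (.ofNat 2))) hr'
  obtain ⟨⟨P, τ, ⟨k, hk⟩, hP⟩, ⟨m, hm⟩⟩ := hU.cons (hr'.cons hsets)
  -- k bounds the time and m the output size; the 1 absorbs their sum, and the factor 2 replaces the
  -- base B + 2 by B², which is larger because B ≥ 2.
  refine ⟨P, 2 * (k + m + 1), fun n r cl hn hr hlen h3 hlt => ?_⟩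
  let p : ι := ⟨(n, r, cl), hn, hr, hlen, h3, hlt⟩
  obtain ⟨t, ht, hE⟩ := hP p
  refine ⟨t, hE, ?_⟩
  have h1 : t ≤ (B p + 2) ^ k := ht.trans (hk p)
  have h2 : (output c n r cl).size ≤ (B p + 2) ^ m := hm p
  have hB : 2 ≤ B p := by
    have h4 : 1 * 2 ≤ n * r := Nat.mul_le_mul hn hr
    exact (by omega : 2 ≤ n * r).trans (Nat.le_mul_of_pos_left _ (by positivity))
  have h3 : (B p + 2) ^ k + (B p + 2) ^ m ≤ (B p + 2) ^ (k + m + 1) := by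
    have h5 : (B p + 2) ^ k ≤ (B p + 2) ^ (k + m) := Nat.pow_le_pow_right (by omega) (by omega)
    have h6 : (B p + 2) ^ m ≤ (B p + 2) ^ (k + m) := Nat.pow_le_pow_right (by omega) (by omega)
    rw [pow_succ]
    nlinarith
  refine (Nat.add_le_add h1 h2).trans (h3.trans ?_)
  rw [pow_mul]
  refine Nat.pow_le_pow_left ?_ _
  show B p + 2 ≤ B p ^ 2
  nlinarith

end Reduction

/-! ### Formulas with natural numbers as variables. -/

namespace ThreeCNF

variable {n : ℕ}

/-- The clauses of a formula, with natural numbers as variables. -/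
def natClauses (φ : ThreeCNF n) : List (List (ℕ × Bool)) :=
  φ.clauses.map fun C => C.map fun l => ((l.var : ℕ), l.sign)

theorem encode_eq (φ : ThreeCNF n) : φ.encode =
    .cons (.ofNat n) (.ofList (.ofList Reduction.encodeLit) φ.natClauses) := by
  rw [encode, natClauses, Data.ofList_map]
  congr 1
  exact Data.ofList_congr fun C _ => (Data.ofList_map Reduction.encodeLit
    (fun l : Literal n => ((l.var : ℕ), l.sign)) C).symm

theorem satisfiable_iff (φ : ThreeCNF n) :
    φ.Satisfiable ↔ ∃ v : ℕ → Bool, ∀ C ∈ φ.natClauses, ∃ l ∈ C, v l.1 = l.2 := by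
  have h : ∀ v : ℕ → Bool, (∀ C ∈ φ.natClauses, ∃ l ∈ C, v l.1 = l.2) ↔
      ∀ C ∈ φ.clauses, ∃ l ∈ C, v l.var = l.sign := by
    intro v
    simp only [natClauses, List.forall_mem_map]
    simp only [List.mem_map]
    refine forall₂_congr fun C _ => ⟨?_, ?_⟩
    · rintro ⟨_, ⟨l, hl, rfl⟩, h⟩
      exact ⟨l, hl, h⟩
    · rintro ⟨l, hl, h⟩
      exact ⟨_, ⟨l, hl, rfl⟩, h⟩
  simp only [h]
  constructor
  · rintro ⟨v, hv⟩
    -- The value outside the range of variables is irrelevant.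
    exact ⟨fun x => if h : x < n then v ⟨x, h⟩ else false, by simpa using hv⟩
  · rintro ⟨v, hv⟩
    exact ⟨fun x => v x, hv⟩

end ThreeCNF

/-! ### Logarithmic estimates and the final theorem. -/

/-- Already N ≥ 2^{n/r} suffices: log 2 ≥ 1/2 gives n/r ≤ 2 log N, to be multiplied by r³. -/
theorem universe_le_mul_log {n r N : ℝ} (hn : 1 ≤ n) (hr : 2 ≤ r)
    (hN : r * 2 ^ (n / r) ≤ N) : n * r ^ 2 ≤ 2 * (r ^ 3 * Real.log N) := by
  have h1 : (2 : ℝ) ^ (n / r) ≤ N := by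
    have : (0 : ℝ) < 2 ^ (n / r) := by positivity
    nlinarith
  have h2 : n / r * Real.log 2 ≤ Real.log N := by
    rw [← Real.log_rpow (by norm_num)]
    exact Real.log_le_log (by positivity) h1
  have h3 := Real.log_two_gt_d9
  have h4 : n / r * (1 / 2) ≤ Real.log N :=
    (mul_le_mul_of_nonneg_left (by linarith) (by positivity)).trans h2
  calc n * r ^ 2 = 2 * (r ^ 3 * (n / r * (1 / 2))) := by field_simp
    _ ≤ _ := by gcongr

/-- In r·log N the terms are r log r, D·n·log 2 and D·r·log 2. The assumption bounds the first by
Kn, and also the last up to the factor D since log 2 ≤ log r. -/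
theorem mul_log_le_universe {n r N D K : ℝ} (hn : 1 ≤ n) (hr : 2 ≤ r) (hD : 0 ≤ D) (hN0 : 0 < N)
    (hN : N ≤ r * 2 ^ (D * (n / r + 1))) (hK : 1 ≤ K) (h : r * Real.log r ≤ K * n) :
    r ^ 3 * Real.log N ≤ (1 + 2 * D) * (K * (n * r ^ 2)) := by
  have h1 : Real.log N ≤ Real.log r + D * (n / r + 1) * Real.log 2 := by
    rw [← Real.log_rpow (by norm_num), ← Real.log_mul (by positivity) (by positivity)]
    exact Real.log_le_log hN0 hN
  have h2 : Real.log 2 ≤ 1 := by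
    have := Real.log_two_lt_d9
    linarith
  have h3 : r * Real.log 2 ≤ K * n :=
    (mul_le_mul_of_nonneg_left (Real.log_le_log (by norm_num) hr) (by linarith)).trans h
  have h4 : n * Real.log 2 ≤ K * n := by
    have := Real.log_two_gt_d9
    nlinarith
  calc r ^ 3 * Real.log N ≤ r ^ 3 * (Real.log r + D * (n / r + 1) * Real.log 2) := by gcongr
    _ = r ^ 2 * (r * Real.log r + D * (n * Real.log 2 + r * Real.log 2)) := by field_simp
    _ ≤ r ^ 2 * (K * n + D * (K * n + K * n)) := by gcongr
    _ = _ := by ring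

theorem lemma2 (c : ℕ) :
    ∃ (a b : ℝ) (e : ℕ), 0 < a ∧ 0 < b ∧
      ∀ (r t : ℕ → ℕ) (R : Prog), R.ComputesIn r t →
        ∃ Q : Prog, ∀ n : ℕ, 1 ≤ n → 2 ≤ r n →
          ∀ φ : ThreeCNF n, φ.Sparse c →
            ∃ (I : SetPacking) (d : Data) (T : ℕ),
              -- the reduction and its running time
              Q.OutputsIn φ.encode d T ∧ I.EncodedBy d ∧
              (T : ℝ) ≤ (t n : ℝ) + 2 ^ ((e : ℝ) * n / r n) * ((n : ℝ) * r n) ^ e ∧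
              -- correctness
              I.param = r n ∧ (φ.Satisfiable ↔ I.HasPacking (r n)) ∧
              -- size of the universe
              a * (n * (r n : ℝ) ^ 2) ≤ I.size ∧
              (I.size : ℝ) ≤ b * (n * (r n : ℝ) ^ 2) ∧
              -- number of sets
              a * (r n * 2 ^ (a * n / r n)) ≤ I.family.card ∧
              (I.family.card : ℝ) ≤ b * (r n * 2 ^ (b * n / r n)) ∧
              -- compactness
              (I.size : ℝ) ≤ b * ((r n : ℝ) ^ 3 * Real.log I.family.card) ∧
              ∀ K : ℝ, 1 ≤ K → r n * Real.log (r n) ≤ K * n →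
                a * ((r n : ℝ) ^ 3 * Real.log I.family.card) ≤ K * I.size := by
  obtain ⟨P, k, hP⟩ := Reduction.exists_prog c
  set D : ℝ := 3 * c + 1 with hD_def
  have hD : 1 ≤ D := by
    have : (0 : ℝ) ≤ c := Nat.cast_nonneg c
    linarith
  have h2D : (0 : ℝ) < 2 ^ D := by positivity
  -- `a` comes from `mul_log_le_universe`. In `b`, the 6 is 3·2 from |U| ≤ 3nr² and
  -- `universe_le_mul_log`, D is the exponent in the number of sets, and 2^D pays for the +1 in
  -- D(n/r + 1). The 3 in the exponent absorbs five extra program steps.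
  refine ⟨1 / (1 + 2 * D), 6 + D + 2 ^ D, k + 3, by positivity, by positivity,
    -- The head of the encoded formula is n in unary, on which `R` is run; its result is paired with
    -- the formula.
    fun r t R hR => ⟨.seq (.cons .arg (.seq .head R)) P, fun n hn hr φ hφ => ?_⟩⟩
  generalize hrn : r n = ρ at *
  have hlen : φ.natClauses.length ≤ c * n := by
    rw [ThreeCNF.natClauses, List.length_map]
    exact hφ
  have h3 : ∀ C ∈ φ.natClauses, C.length ≤ 3 := by
    simpa [ThreeCNF.natClauses] using φ.length_le
  have hlt : ∀ C ∈ φ.natClauses, ∀ l ∈ C, l.1 < n := by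
    simp only [ThreeCNF.natClauses, List.forall_mem_map]
    exact fun C _ l _ => l.var.2
  obtain ⟨tR, hER, htR⟩ := hR n
  rw [hrn] at hER htR
  obtain ⟨tP, hEP, htP⟩ := hP n ρ φ.natClauses hn hr hlen h3 hlt
  obtain ⟨I, hsize, hparam, henc, hcard, hpack⟩ :=
    SetPacking.exists_encodedBy (U := Reduction.universeSize n ρ) (r := ρ)
      (L := Reduction.packingSets c n ρ φ.natClauses)
      (fun s hs => by
        obtain ⟨i, hi, α, hα, rfl⟩ := Reduction.mem_packingSets.1 hs
        exact fun e he =>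
          Reduction.lt_universeSize (Reduction.lt_of_mem_of_mem_assignments hα) hi he)
      (fun s hs => by
        obtain ⟨i, hi, α, hα, rfl⟩ := Reduction.mem_packingSets.1 hs
        exact Reduction.nodup_assignmentSet (Reduction.lt_of_mem_of_mem_assignments hα)
          (Reduction.map_fst_of_mem_assignments hα ▸ Reduction.nodup_groupVars _ _ _) hi)
      (Reduction.nodup_map_toFinset_packingSets hn hr)
  have hn' : (1 : ℝ) ≤ n := by exact_mod_cast hn
  have hr' : (2 : ℝ) ≤ ρ := by exact_mod_cast hr
  have hfloor : ((n / ρ : ℕ) : ℝ) ≤ n / ρ := Nat.cast_div_le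
  have hfloor' : (n : ℝ) / ρ ≤ ((n / ρ + 1 : ℕ) : ℝ) := by
    rw [div_le_iff₀ (by linarith)]
    have := (Nat.lt_div_mul_add (a := n) (by omega : 0 < ρ)).le
    have h : n ≤ (n / ρ + 1) * ρ := by rw [Nat.succ_mul]; exact this
    exact_mod_cast h
  have hUcast : (I.size : ℝ) = 2 * (n * (ρ : ℝ) ^ 2) + ρ := by
    rw [hsize, Reduction.universeSize]
    push_cast
    ring
  have hUle : (I.size : ℝ) ≤ 3 * (n * (ρ : ℝ) ^ 2) := by
    rw [hUcast]
    nlinarith [mul_le_mul hn' (mul_le_mul_of_nonneg_left hr' (by linarith : (0 : ℝ) ≤ ρ))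
      (by positivity) (by linarith)]
  have hcard1 : (ρ : ℝ) * 2 ^ ((n : ℝ) / ρ) ≤ I.family.card := by
    rw [hcard]
    calc (ρ : ℝ) * 2 ^ ((n : ℝ) / ρ) ≤ ρ * 2 ^ (((n / ρ + 1 : ℕ) : ℝ)) := by
          gcongr
          norm_num
      _ = ((ρ * 2 ^ (n / ρ + 1) : ℕ) : ℝ) := by
          rw [Real.rpow_natCast]
          push_cast
          rfl
      _ ≤ _ := by exact_mod_cast Reduction.le_length_packingSets hn hr
  have hcard2 : (I.family.card : ℝ) ≤ ρ * 2 ^ (D * (n / ρ + 1)) := by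
    rw [hcard]
    calc ((Reduction.packingSets c n ρ φ.natClauses).length : ℝ)
        ≤ ((ρ * 2 ^ ((3 * c + 1) * (n / ρ + 1)) : ℕ) : ℝ) := by
          exact_mod_cast Reduction.length_packingSets_le (by omega) h3
      _ = ρ * 2 ^ (D * ((n / ρ : ℕ) + 1)) := by
          have h4 : D * ((n / ρ : ℕ) + 1) = (((3 * c + 1) * (n / ρ + 1) : ℕ) : ℝ) := by
            rw [hD_def]
            push_cast
            rfl
          rw [h4, Real.rpow_natCast]
          push_cast
          rfl
      _ ≤ _ := by
          gcongr
          norm_num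
  have hcard0 : (0 : ℝ) < I.family.card := lt_of_lt_of_le (by positivity) hcard1
  have hlog := universe_le_mul_log hn' hr' hcard1
  have ha : 1 / (1 + 2 * D) ≤ 1 := by
    rw [div_le_one (by positivity)]
    linarith
  refine ⟨I, Reduction.output c n ρ φ.natClauses, tR + 5 + (tP + (Reduction.output c n ρ φ.natClauses).size),
    ⟨1 + (1 + tR + 1) + 1 + tP + 1, ?_, by omega⟩, henc, ?_, hparam, ?_, ?_, ?_, ?_, ?_, ?_, ?_⟩
  · rw [ThreeCNF.encode_eq]
    exact .seq (.cons (.arg _) (.seq (.head _) hER)) hEP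
  · set m := 2 ^ (n / ρ) * (n * ρ) with hm
    have hm2 : 2 ≤ m := by
      have h4 : 1 * 2 ≤ n * ρ := Nat.mul_le_mul hn hr
      exact (by omega : 2 ≤ n * ρ).trans (Nat.le_mul_of_pos_left _ (by positivity))
    have h5 : 5 + m ^ k ≤ m ^ (k + 3) := by
      have h6 : 2 ^ 3 ≤ m ^ 3 := Nat.pow_le_pow_left hm2 3
      have h7 : 1 ≤ m ^ k := Nat.one_le_pow _ _ (by omega)
      rw [pow_add]
      nlinarith
    have h8 : tR + 5 + (tP + (Reduction.output c n ρ φ.natClauses).size) ≤ t n + m ^ (k + 3) := by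
      omega
    have h9 : ((m : ℕ) : ℝ) ^ (k + 3) ≤
        2 ^ (((k + 3 : ℕ) : ℝ) * n / ρ) * ((n : ℝ) * ρ) ^ (k + 3) := by
      rw [hm]
      push_cast
      rw [mul_pow, ← pow_mul, ← Real.rpow_natCast]
      gcongr
      · norm_num
      · push_cast
        rw [mul_comm, mul_div_assoc]
        gcongr
    calc ((tR + 5 + (tP + (Reduction.output c n ρ φ.natClauses).size) : ℕ) : ℝ)
        ≤ ((t n + m ^ (k + 3) : ℕ) : ℝ) := by exact_mod_cast h8
      _ = t n + (m : ℝ) ^ (k + 3) := by push_cast; rfl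
      _ ≤ _ := by gcongr
  · rw [φ.satisfiable_iff, hpack]
    exact ⟨fun ⟨v, hv⟩ => Reduction.exists_packing_of_satisfiable hn hlt hv,
      fun ⟨A, hA, hAr, hd⟩ => Reduction.satisfiable_of_exists_packing hr hlen hA hAr hd⟩
  · rw [hUcast]
    have : 1 / (1 + 2 * D) * (n * (ρ : ℝ) ^ 2) ≤ 1 * (n * (ρ : ℝ) ^ 2) := by gcongr
    nlinarith
  · refine hUle.trans ?_
    gcongr
    linarith
  · refine le_trans ?_ hcard1
    have h4 : (2 : ℝ) ^ (1 / (1 + 2 * D) * n / ρ) ≤ 2 ^ ((n : ℝ) / ρ) := by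
      refine Real.rpow_le_rpow_of_exponent_le (by norm_num) ?_
      gcongr
      exact mul_le_of_le_one_left (by linarith) ha
    calc _ ≤ 1 * ((ρ : ℝ) * 2 ^ (1 / (1 + 2 * D) * n / ρ)) := by gcongr
      _ ≤ _ := by
        rw [one_mul]
        gcongr
  · refine hcard2.trans ?_
    rw [mul_add, mul_one, Real.rpow_add (by norm_num)]
    calc (ρ : ℝ) * (2 ^ (D * (n / ρ)) * 2 ^ D) = 2 ^ D * (ρ * 2 ^ (D * n / ρ)) := by
          rw [mul_div_assoc]
          ring
      _ ≤ _ := by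
          gcongr
          · linarith
          · norm_num
          · linarith
  · refine hUle.trans ?_
    have h0 : 0 ≤ (ρ : ℝ) ^ 3 * Real.log I.family.card := by
      have : 0 ≤ n * (ρ : ℝ) ^ 2 := by positivity
      linarith
    nlinarith
  · intro K hK h
    have h4 := mul_log_le_universe hn' hr' (by linarith) hcard0 hcard2 hK h
    rw [div_mul_eq_mul_div, one_mul, div_le_iff₀ (by positivity), mul_comm _ (1 + 2 * D)]
    refine h4.trans ?_
    rw [hUcast]
    gcongr
    have : 0 ≤ n * (ρ : ℝ) ^ 2 := by positivity
    linarith
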